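/- **Setting (censor block model).** Let $V$ have $2n$ vertices, and let $x\in\{0,1\}^V$ have exactly $n$ coordinates equal to $1$; put $V_1=\{i:x_i=0\}$ and $V_2=\{i:x_i=1\}$. Let $G\sim G(2n,p)$ (every pair of vertices is an edge independently with probability $p$), let $B_G$ be its edge–vertex incidence matrix, and, given $G$, let $z$ be a vector indexed by the edges of $G$ with i.i.d. $\mathrm{Bernoulli}(\varepsilon)$ coordinates. One observes $G$ and $y=B_Gx\oplus z$ (addition mod $2$), i.e. $y_{ij}=x_i\oplus x_j\oplus z_{ij}$ for every edge $ij$. Let $Y$ be the symmetric $2n\times 2n$ matrix with $Y_{ij}=y_{ij}\in\{0,1\}$ if $ij$ is an edge and $Y_{ij}=0$ otherwise. **Algorithm.** On input $(Y,p)$: (1) zero out all rows and columns of $Y$ at vertices $i$ whose degree $\sum_jY_{ij}$ is larger than $20pn$, to get $Y_0$; (2) let $U$ be the $2$-dimensional space spanned by (orthonormal) eigenvectors of $Y_0$ for its two eigenvalues of largest absolute value (counted with multiplicity); (3) let $v_1$ be the orthogonal projection of the all-ones vector on $U$ and $v_2$ a unit vector of $U$ perpendicular to $v_1$; (4) sort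 the vertices by their values in $v_2$, let $V_1'$ be the top $n$ vertices and $V_2'=V\setminus V_1'$, and output $\{V_1',V_2'\}$. Ties, and the choice of $v_2$, are resolved arbitrarily. The partition $\{V_1',V_2'\}$ is called $\gamma$-correct if, possibly after exchanging the names of $V_1'$ and $V_2'$, $|V_i\cap V_i'|\ge(1-\gamma)n$ for $i=1,2$. **Theorem.** For every $\gamma>0$ and every $0<\varepsilon_0<\tfrac12$ there are constants $C_1,C_2>0$, depending only on $\gamma$ and $\varepsilon_0$, such that for every fixed $\varepsilon\in[\varepsilon_0,\tfrac12)$ the following holds. If $$np\ \ge\ \frac{C_1}{(1-2\varepsilon)^2}\qquad\text{and}\qquad p\ \ge\ \frac{C_2}{n},$$ then with probability $1-o(1)$ as $n\to\infty$ every possible output of the algorithm (there is at least one) is a $\gamma$-correct partition. Here $o(1)$ is uniform over all $p\in[0,1]$ satisfying the two conditions and over all $x$ with exactly $n$ ones. (In particular, taking $\varepsilon_0=\varepsilon$, for any given constants $\gamma>0$ and $0<\varepsilon<\tfrac12$ there are such $C_1,C_2$.) -/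

import Mathlib

open MeasureTheory ProbabilityTheory Filter Topology

namespace CensorBlock

noncomputable section

/-- The community `{i | x i = a}` of a labelling `x` of the vertices. -/
def block {V : Type*} [Fintype V] (x : V → ZMod 2) (a : ZMod 2) : Finset V :=
  Finset.univ.filter fun i => x i = a

/-- The joint law of the random graph `G ∼ G(2n, p)` and of independent i.i.d. Bernoulli(`ε`) marks
(`1` with probability `ε`, `0` otherwise) on the unordered pairs of vertices; only the marks on
the edges of `G` enter the observation below, so given `G` the noise is i.i.d. Bernoulli(`ε`) on
the edges. -/
def law (n : ℕ) (p ε : unitInterval) :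
    Measure (SimpleGraph (Fin (2 * n)) × (Sym2 (Fin (2 * n)) → ZMod 2)) :=
  (SimpleGraph.binomialRandom (Fin (2 * n)) p).prod
    (Measure.pi fun _ : Sym2 (Fin (2 * n)) => bernoulliMeasure (1 : ZMod 2) 0 ε)

open Classical in
/-- The noisy observation `y = B_G x ⊕ z`, a vector over `ℤ/2` indexed by the edges of `G`, where
`B_G` is the edge-vertex incidence matrix. -/
def observation {V : Type*} [Fintype V] (G : SimpleGraph V) (x : V → ZMod 2)
    (z : Sym2 V → ZMod 2) (e : G.edgeSet) : ZMod 2 :=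
  ((G.incMatrix (ZMod 2)).transpose.mulVec x) e + z e

open Classical in
/-- The symmetric 0/1 matrix `Y` of a labelled graph: `Y i j` is the label of the edge `ij`, and
`0` if `ij` is not an edge. -/
def labelMatrix {V : Type*} (G : SimpleGraph V) (y : G.edgeSet → ZMod 2) : Matrix V V ℝ :=
  Matrix.of fun i j =>
    if h : G.Adj i j then (if y ⟨s(i, j), h⟩ = 1 then 1 else 0) else 0

/-- The degree of a vertex in (the graph with adjacency matrix) `Y`. -/
def degree {V : Type*} [Fintype V] (Y : Matrix V V ℝ) (i : V) : ℝ := ∑ j, Y i j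

open Classical in
/-- Zero out the rows and the columns of `Y` at the vertices of degree larger than `t`. -/
def trim {V : Type*} [Fintype V] (Y : Matrix V V ℝ) (t : ℝ) : Matrix V V ℝ :=
  Matrix.of fun i j => if t < degree Y i ∨ t < degree Y j then 0 else Y i j

open Classical in
/-- `U` is spanned by the eigenvectors of the two eigenvalues of `A` that are largest in absolute
value: there is an orthonormal eigenbasis `b`, with eigenvalues `μ`, such that `U` is the span of
two of its vectors, whose eigenvalues dominate all the others in absolute value. (If there are
ties, several planes qualify.) -/
def IsTopEigenspace {V : Type*} [Fintype V] (A : Matrix V V ℝ)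
    (U : Submodule ℝ (EuclideanSpace ℝ V)) : Prop :=
  ∃ (b : OrthonormalBasis V ℝ (EuclideanSpace ℝ V)) (μ : V → ℝ) (S : Finset V),
    (∀ i, Matrix.toEuclideanLin A (b i) = μ i • b i) ∧ S.card = 2 ∧
    (∀ i ∈ S, ∀ j ∉ S, |μ j| ≤ |μ i|) ∧ U = Submodule.span ℝ (b '' (S : Set V))

/-- `(V₁, V₂)` is a possible output of the spectral algorithm on the input `Y`, `p`. The choices
the algorithm leaves open (the sign of `v₂`, ties in the sorting, ties among eigenvalues) may be
made in any way. -/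
def IsSpectralOutput (n : ℕ) (p : ℝ) (Y : Matrix (Fin (2 * n)) (Fin (2 * n)) ℝ)
    (V₁ V₂ : Finset (Fin (2 * n))) : Prop :=
  ∃ (U : Submodule ℝ (EuclideanSpace ℝ (Fin (2 * n)))) (v₁ v₂ : EuclideanSpace ℝ (Fin (2 * n))),
    IsTopEigenspace (trim Y (20 * p * n)) U ∧
    v₁ = U.starProjection (WithLp.toLp 2 fun _ => (1 : ℝ)) ∧
    v₂ ∈ U ∧ ‖v₂‖ = 1 ∧ inner ℝ v₁ v₂ = 0 ∧
    V₁.card = n ∧ (∀ i ∈ V₁, ∀ j ∉ V₁, v₂ j ≤ v₂ i) ∧ V₂ = V₁ᶜ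

/-- `(V₁', V₂')` is `γ`-correct for the blocks `V₁, V₂` of size `n`. -/
def GammaCorrect {V : Type*} [DecidableEq V] (n : ℕ) (γ : ℝ) (V₁ V₂ V₁' V₂' : Finset V) : Prop :=
  (1 - γ) * n ≤ ((V₁ ∩ V₁').card : ℝ) ∧ (1 - γ) * n ≤ ((V₂ ∩ V₂').card : ℝ)

/-- `γ`-correctness of the unordered partition `{V₁', V₂'}`: the names of the two parts, which the
observation cannot determine, are disregarded. -/
def GammaCorrectPartition {V : Type*} [DecidableEq V] (n : ℕ) (γ : ℝ)
    (V₁ V₂ V₁' V₂' : Finset V) : Prop :=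
  GammaCorrect n γ V₁ V₂ V₁' V₂' ∨ GammaCorrect n γ V₁ V₂ V₂' V₁'

/-- The event that the spectral algorithm has an output, and that each of its possible outputs is
a `γ`-correct partition. -/
def successEvent (n : ℕ) (p γ : ℝ) (x : Fin (2 * n) → ZMod 2) :
    Set (SimpleGraph (Fin (2 * n)) × (Sym2 (Fin (2 * n)) → ZMod 2)) :=
  {ω | (∃ V₁' V₂', IsSpectralOutput n p (labelMatrix ω.1 (observation ω.1 x ω.2)) V₁' V₂') ∧
    ∀ V₁' V₂', IsSpectralOutput n p (labelMatrix ω.1 (observation ω.1 x ω.2)) V₁' V₂' →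
      GammaCorrectPartition n γ (block x 0) (block x 1) V₁' V₂'}

end

end CensorBlock

/-!
The expectation of `Y` agrees off the diagonal with a matrix of rank two whose eigenvectors are the
all-ones vector and the sign vector of the two communities, with eigenvalues `np` and
`-(1 - 2ε)np`. By the Kahn–Szemerédi method the trimmed matrix is within `O(√(np))` of it in
operator norm: it suffices to test integer vectors `z` with `∑ zᵢ² = O(|V|)`, and in the quadratic
form the light pairs (small `|zᵢ zⱼ|`) are controlled by a Chernoff bound and a union bound over
all `z`, while the heavy pairs are controlled by the discrepancy of the edge counts between the
dyadic level sets of `z`, together with the degree bound provided by the trimming. As soon as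
`|1 - 2ε|np` is a large multiple of `√(np)`, a unit vector of the top eigenspace orthogonal to the
all-ones vector is therefore close to a multiple `c` of the sign vector, and in its ordering each
misplaced vertex costs `c²` of that small distance.
-/

namespace CensorBlock

noncomputable section

section Levels

lemma four_pow_eq (k : ℕ) : (4 : ℝ) ^ k = 2 ^ k * 2 ^ k := by
  rw [← mul_pow]; norm_num

/-- An upper bound for the logarithm of the number of `a`-element subsets of an `N`-element set. -/
def entropyWeight (N a : ℝ) : ℝ := a * (1 + Real.log (N / a))

lemma entropyWeight_le {N a : ℝ} (hN : 0 < N) (ha : 0 < a) : entropyWeight N a ≤ N := by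
  have h := Real.log_le_sub_one_of_pos (div_pos hN ha)
  calc entropyWeight N a ≤ a * (1 + (N / a - 1)) := by unfold entropyWeight; gcongr
    _ = N := by field_simp; ring

lemma entropyWeight_le_add_div_pow {N a : ℝ} (hN : 0 < N) (ha : 0 < a) (t : ℕ) :
    entropyWeight N a ≤ a * (1 + 3 * t) + N / 16 ^ t := by
  have log_sixteen_le : Real.log 16 ≤ 3 := by
    rw [show (16 : ℝ) = 2 ^ 4 by norm_num, Real.log_pow]
    have := Real.log_two_lt_d9
    push_cast; linarith
  have log_split : Real.log (N / a) = t * Real.log 16 + Real.log (N / 16 ^ t / a) := by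
    rw [← Real.log_pow, ← Real.log_mul (by positivity) (by positivity)]
    congr 1; field_simp
  have log_le := Real.log_le_sub_one_of_pos (show 0 < N / 16 ^ t / a by positivity)
  calc entropyWeight N a ≤ a * (1 + (t * 3 + N / 16 ^ t / a)) := by
        unfold entropyWeight; rw [log_split]; gcongr; linarith
    _ = _ := by field_simp; ring

lemma sum_pow_filter_le {ρ X : ℝ} (hρ : 1 < ρ) (hX : 0 ≤ X) (F : Finset ℕ) :
    ∑ s ∈ F with ρ ^ s ≤ X, ρ ^ s ≤ ρ / (ρ - 1) * X := by
  have : 0 < ρ - 1 := by linarith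
  rcases (F.filter fun s => ρ ^ s ≤ X).eq_empty_or_nonempty with h | h
  · rw [h, Finset.sum_empty]; positivity
  · set M := (F.filter fun s => ρ ^ s ≤ X).max' h
    have hM : ρ ^ M ≤ X := (Finset.mem_filter.1 (Finset.max'_mem _ h)).2
    have hsub : (F.filter fun s => ρ ^ s ≤ X) ⊆ Finset.range (M + 1) := fun s hs =>
      Finset.mem_range.2 (Nat.lt_succ_of_le (Finset.le_max' _ s hs))
    calc ∑ s ∈ F with ρ ^ s ≤ X, ρ ^ s ≤ ∑ s ∈ Finset.range (M + 1), ρ ^ s :=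
          Finset.sum_le_sum_of_subset_of_nonneg hsub fun _ _ _ => by positivity
      _ = (ρ ^ (M + 1) - 1) / (ρ - 1) := geom_sum_eq hρ.ne' _
      _ ≤ (ρ * X) / (ρ - 1) := by
          gcongr
          rw [pow_succ']
          nlinarith
      _ = _ := by ring

lemma sum_two_pow_filter_le {X : ℝ} (hX : 0 ≤ X) (F : Finset ℕ) :
    ∑ s ∈ F with (2 : ℝ) ^ s ≤ X, (2 : ℝ) ^ s ≤ 2 * X :=
  (sum_pow_filter_le one_lt_two hX F).trans_eq (by norm_num)

lemma sum_sqrt_two_pow_filter_le {X : ℝ} (hX : 0 ≤ X) (F : Finset ℕ) :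
    ∑ s ∈ F with (2 : ℝ) ^ s ≤ X, √(2 ^ s) ≤ 4 * √X := by
  have sqrt_two_gt : (1.4 : ℝ) < √2 := by
    rw [Real.lt_sqrt] <;> norm_num
  have sqrt_pow (s : ℕ) : √((2 : ℝ) ^ s) = √2 ^ s := by
    rw [Real.sqrt_eq_iff_mul_self_eq (by positivity) (by positivity), ← mul_pow,
      Real.mul_self_sqrt zero_le_two]
  have filter_eq : (F.filter fun s => (2 : ℝ) ^ s ≤ X) = F.filter fun s => √2 ^ s ≤ √X :=
    Finset.filter_congr fun s _ => by rw [← sqrt_pow, Real.sqrt_le_sqrt_iff hX]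
  simp_rw [filter_eq, sqrt_pow]
  refine (sum_pow_filter_le (by linarith) (Real.sqrt_nonneg X) F).trans ?_
  gcongr
  rw [div_le_iff₀ (by linarith)]
  linarith

/-- The exponent used in the Chernoff bound for the number of edges between two level sets of a
vector whose dyadic levels add up to `m`. -/
def levelExponent (D : ℝ) (m : ℕ) : ℝ := 1 + Real.log (4 * 2 ^ m / D)

lemma exp_levelExponent {D : ℝ} (hD : 0 < D) (m : ℕ) :
    Real.exp (levelExponent D m) = Real.exp 1 * (4 * 2 ^ m / D) := by
  rw [levelExponent, Real.exp_add, Real.exp_log (by positivity)]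

/-- Two dyadic levels are balanced if neither `2 ^ s` nor `2 ^ t` dominates the other by a factor
`D`, while a product of two values of these levels may exceed `D`. -/
def Balanced (D : ℝ) (s t : ℕ) : Prop :=
  (2 : ℝ) ^ s ≤ D * 2 ^ t ∧ (2 : ℝ) ^ t ≤ D * 2 ^ s ∧ D < 4 * 2 ^ (s + t)

lemma Balanced.symm {D : ℝ} {s t : ℕ} (h : Balanced D s t) : Balanced D t s :=
  ⟨h.2.1, h.1, by rw [add_comm]; exact h.2.2⟩

lemma balanced_comm {D : ℝ} {s t : ℕ} : Balanced D s t ↔ Balanced D t s :=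
  ⟨Balanced.symm, Balanced.symm⟩

lemma Balanced.one_le_levelExponent {D : ℝ} (hD : 0 < D) {s t : ℕ} (h : Balanced D s t) :
    1 ≤ levelExponent D (s + t) :=
  le_add_of_nonneg_right (Real.log_nonneg ((one_le_div hD).2 h.2.2.le))

lemma Balanced.mul_sqrt_le {D : ℝ} (hD : 0 < D) {s t : ℕ} (h : Balanced D s t) :
    (1 + 3 * t : ℝ) * √(2 ^ s) ≤ 9 * levelExponent D (s + t) * √(D * 2 ^ t) := by
  have one_le_exponent := h.one_le_levelExponent hD
  set q : ℝ := D * 2 ^ t / 2 ^ s with hq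
  have one_le_sqrt : 1 ≤ √q := Real.one_le_sqrt.2 ((one_le_div (by positivity)).2 h.1)
  have sqrt_eq : √(D * 2 ^ t) = √q * √(2 ^ s) := by
    rw [← Real.sqrt_mul (by positivity), hq]; congr 1; field_simp
  have log_q_le : Real.log q ≤ 2 * √q := by
    have := Real.log_le_sub_one_of_pos (show 0 < √q by positivity)
    rw [Real.log_sqrt (by positivity)] at this
    linarith
  have log_four_eq : (t + 1) * Real.log 4 = levelExponent D (s + t) - 1 + Real.log q := by
    rw [levelExponent, add_sub_cancel_left, ← Real.log_mul (by positivity) (by positivity),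
      ← Nat.cast_succ, ← Real.log_pow]
    congr 1
    rw [hq, pow_add, pow_succ, four_pow_eq]
    field_simp
  have one_le_log_four : 1 ≤ Real.log 4 := by
    rw [show (4 : ℝ) = 2 ^ 2 by norm_num, Real.log_pow]
    have := Real.log_two_gt_d9
    push_cast; linarith
  have : (0 : ℝ) ≤ t := Nat.cast_nonneg t
  have level_le : (1 + 3 * t : ℝ) ≤ 9 * levelExponent D (s + t) * √q := by
    nlinarith [mul_nonneg (sub_nonneg.2 one_le_exponent) (sub_nonneg.2 one_le_sqrt)]
  rw [sqrt_eq, ← mul_assoc]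
  gcongr

/-- The entries of a quadratic form at levels `s`, `t`, divided by the Chernoff exponent: the factor
by which entropy enters the contribution of these levels. -/
def levelWeight (D : ℝ) (s t : ℕ) : ℝ := 4 * 2 ^ s * 2 ^ t / levelExponent D (s + t)

lemma levelWeight_comm (D : ℝ) (s t : ℕ) : levelWeight D s t = levelWeight D t s := by
  simp only [levelWeight, add_comm s t, mul_right_comm]

lemma Balanced.levelWeight_le {D : ℝ} (hD : 0 < D) {s t : ℕ} (h : Balanced D s t) :
    levelWeight D s t ≤ 4 * 2 ^ t * 2 ^ s :=
  (div_le_self (by positivity) (h.one_le_levelExponent hD)).trans_eq (mul_right_comm _ _ _)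

lemma Balanced.levelWeight_mul_le {D : ℝ} (hD : 0 < D) {s t : ℕ} (h : Balanced D s t) :
    levelWeight D s t * (1 + 3 * t) ≤ 36 * 2 ^ t * √(D * 2 ^ t) * √(2 ^ s) := by
  have one_le_exponent := h.one_le_levelExponent hD
  have two_pow_eq : (2 : ℝ) ^ s = √(2 ^ s) * √(2 ^ s) := (Real.mul_self_sqrt (by positivity)).symm
  rw [levelWeight, div_mul_eq_mul_div, div_le_iff₀ (by linarith)]
  calc 4 * 2 ^ s * 2 ^ t * (1 + 3 * t : ℝ)
      = 4 * √(2 ^ s) * 2 ^ t * ((1 + 3 * t) * √(2 ^ s)) := by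
        nth_rewrite 1 [two_pow_eq]; ring
    _ ≤ 4 * √(2 ^ s) * 2 ^ t * (9 * levelExponent D (s + t) * √(D * 2 ^ t)) := by
        gcongr 4 * √(2 ^ s) * 2 ^ t * ?_
        exact h.mul_sqrt_le hD
    _ = _ := by ring

open Classical in
lemma sum_balanced_le_sum_two_pow_le {D : ℝ} {t : ℕ} (F : Finset ℕ) {f g : ℕ → ℝ}
    (hg : ∀ s, 0 ≤ g s) (hfg : ∀ s, Balanced D s t → f s ≤ g s) :
    ∑ s ∈ F with Balanced D s t, f s ≤ ∑ s ∈ F with (2 : ℝ) ^ s ≤ D * 2 ^ t, g s := by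
  calc ∑ s ∈ F with Balanced D s t, f s ≤ ∑ s ∈ F with Balanced D s t, g s :=
        Finset.sum_le_sum fun s hs => hfg s (Finset.mem_filter.1 hs).2
    _ ≤ _ := Finset.sum_le_sum_of_subset_of_nonneg
        (Finset.monotone_filter_right F fun _ _ h => h.1) fun s _ _ => hg s

open Classical in
lemma sum_balanced_levelWeight_le {D : ℝ} (hD : 0 < D) (F : Finset ℕ) (t : ℕ) :
    ∑ s ∈ F with Balanced D s t, levelWeight D s t ≤ 8 * D * 4 ^ t := by
  calc ∑ s ∈ F with Balanced D s t, levelWeight D s t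
      ≤ ∑ s ∈ F with (2 : ℝ) ^ s ≤ D * 2 ^ t, 4 * 2 ^ t * (2 : ℝ) ^ s :=
        sum_balanced_le_sum_two_pow_le F (fun _ => by positivity) fun _ h => h.levelWeight_le hD
    _ ≤ 4 * 2 ^ t * (2 * (D * 2 ^ t)) := by
        rw [← Finset.mul_sum]
        gcongr
        exact sum_two_pow_filter_le (by positivity) F
    _ = _ := by rw [four_pow_eq]; ring

open Classical in
lemma sum_balanced_levelWeight_mul_le {D : ℝ} (hD : 0 < D) (F : Finset ℕ) (t : ℕ) :
    (∑ s ∈ F with Balanced D s t, levelWeight D s t) * (1 + 3 * t) ≤ 144 * D * 4 ^ t := by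
  calc (∑ s ∈ F with Balanced D s t, levelWeight D s t) * (1 + 3 * t)
      ≤ ∑ s ∈ F with (2 : ℝ) ^ s ≤ D * 2 ^ t, 36 * 2 ^ t * √(D * 2 ^ t) * √(2 ^ s) := by
        rw [Finset.sum_mul]
        exact sum_balanced_le_sum_two_pow_le F (fun _ => by positivity) fun _ h =>
          h.levelWeight_mul_le hD
    _ ≤ 36 * 2 ^ t * √(D * 2 ^ t) * (4 * √(D * 2 ^ t)) := by
        rw [← Finset.mul_sum]
        gcongr
        exact sum_sqrt_two_pow_filter_le (by positivity) F
    _ = 144 * 2 ^ t * (√(D * 2 ^ t) * √(D * 2 ^ t)) := by ring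
    _ = _ := by rw [Real.mul_self_sqrt (by positivity), four_pow_eq]; ring

/-- The entropy term that a level set of size `a` at level `t`, inside a set of size `N`,
contributes against a set at level `s`. -/
def levelCost (D N a : ℝ) (s t : ℕ) : ℝ :=
  3 * (levelWeight D s t * (a * (1 + 3 * t) + N / 16 ^ t))

lemma sum_quarter_pow_le (F : Finset ℕ) : ∑ t ∈ F, ((1 : ℝ) / 4) ^ t ≤ 2 :=
  ((summable_geometric_of_lt_one (by norm_num) (by norm_num)).sum_le_tsum F
    fun _ _ => by positivity).trans
    ((tsum_geometric_of_lt_one (by norm_num) (by norm_num)).trans_le (by norm_num))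

open Classical in
lemma sum_balanced_levelCost_le {D N : ℝ} (hD : 0 < D) (hN : 0 ≤ N) (F : Finset ℕ) {a : ℕ → ℝ}
    (ha : ∀ t, 0 ≤ a t) (hsum : ∑ t ∈ F, 4 ^ t * a t ≤ 16 * N) :
    ∑ t ∈ F, ∑ s ∈ F with Balanced D s t, levelCost D N (a t) s t ≤ 6960 * D * N := by
  have level_le (t : ℕ) : ∑ s ∈ F with Balanced D s t, levelCost D N (a t) s t ≤
      432 * D * (4 ^ t * a t) + 24 * D * N * (1 / 4) ^ t := by
    have hat := ha t
    have four_div_sixteen : (4 : ℝ) ^ t / 16 ^ t = (1 / 4) ^ t := by rw [← div_pow]; norm_num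
    simp only [levelCost]
    rw [← Finset.mul_sum, ← Finset.sum_mul]
    set S := ∑ s ∈ F with Balanced D s t, levelWeight D s t
    calc 3 * (S * (a t * (1 + 3 * t) + N / 16 ^ t))
        = 3 * (a t * (S * (1 + 3 * t)) + S * (N / 16 ^ t)) := by ring
      _ ≤ 3 * (a t * (144 * D * 4 ^ t) + (8 * D * 4 ^ t) * (N / 16 ^ t)) := by
          gcongr 3 * (a t * ?_ + ?_ * (N / 16 ^ t))
          · exact sum_balanced_levelWeight_mul_le hD F t
          · exact sum_balanced_levelWeight_le hD F t
      _ = 432 * D * (4 ^ t * a t) + 24 * D * N * (4 ^ t / 16 ^ t) := by ring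
      _ = _ := by rw [four_div_sixteen]
  calc _ ≤ ∑ t ∈ F, (432 * D * (4 ^ t * a t) + 24 * D * N * (1 / 4) ^ t) :=
        Finset.sum_le_sum fun t _ => level_le t
    _ = 432 * D * ∑ t ∈ F, 4 ^ t * a t + 24 * D * N * ∑ t ∈ F, ((1 : ℝ) / 4) ^ t := by
        rw [Finset.sum_add_distrib, Finset.mul_sum, Finset.mul_sum]
    _ ≤ 432 * D * (16 * N) + 24 * D * N * 2 := by
        gcongr
        exact sum_quarter_pow_le F
    _ = _ := by ring

end Levels

section Discrepancy

variable {V : Type*} [Fintype V]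

/-- The number of edges (with weights `T`) between two sets never exceeds its Chernoff bound with
exponent `θ`, when every edge has mean at most `p`. -/
def Discrepancy (T : V → V → ℝ) (p θ : ℝ) : Prop :=
  ∀ A B : Finset V, A.Nonempty → B.Nonempty →
    (∑ i ∈ A, ∑ j ∈ B, T i j) * θ ≤ p * A.card * B.card * Real.exp θ +
      3 * entropyWeight (Fintype.card V) A.card + 3 * entropyWeight (Fintype.card V) B.card

lemma pos_and_pos_of_mul_eq_two_mul_sq {p N D : ℝ} (hD : 0 < D) (hN : 0 ≤ N)
    (hpN : p * N = 2 * D ^ 2) : 0 < p ∧ 0 < N := by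
  have mul_pos : 0 < p * N := hpN ▸ by positivity
  have N_pos : 0 < N := hN.lt_of_ne fun h => by simp [← h] at mul_pos
  exact ⟨pos_of_mul_pos_left mul_pos hN, N_pos⟩

lemma Balanced.mul_sum_le {T : V → V → ℝ} {p D : ℝ} (hD : 0 < D) (hp : 0 ≤ p) {s t : ℕ}
    (hb : Balanced D s t) (hT : Discrepancy T p (levelExponent D (s + t))) {A B : Finset V}
    (hA : A.Nonempty) (hB : B.Nonempty) :
    4 * 2 ^ s * 2 ^ t * (∑ i ∈ A, ∑ j ∈ B, T i j) ≤
      16 * Real.exp 1 * p / D * ((4 ^ s * A.card) * (4 ^ t * B.card)) +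
      levelCost D (Fintype.card V) B.card s t + levelCost D (Fintype.card V) A.card t s := by
  have one_le_exponent := hb.one_le_levelExponent hD
  have hA' : (0 : ℝ) < A.card := by exact_mod_cast hA.card_pos
  have hB' : (0 : ℝ) < B.card := by exact_mod_cast hB.card_pos
  have hN : (0 : ℝ) < Fintype.card V := by
    exact_mod_cast hA.card_pos.trans_le (Finset.card_le_univ A)
  have chernoff := hT A B hA hB
  rw [exp_levelExponent hD] at chernoff
  have entropy_A := entropyWeight_le_add_div_pow hN hA' s
  have entropy_B := entropyWeight_le_add_div_pow hN hB' t
  simp only [levelCost, levelWeight_comm D t s]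
  unfold levelWeight
  set θ := levelExponent D (s + t)
  set N : ℝ := (Fintype.card V : ℝ)
  set E := ∑ i ∈ A, ∑ j ∈ B, T i j
  have hθ : 0 < θ := by linarith
  have edges_le : E ≤ (p * A.card * B.card * (Real.exp 1 * (4 * 2 ^ (s + t) / D)) +
      3 * (B.card * (1 + 3 * t) + N / 16 ^ t) + 3 * (A.card * (1 + 3 * s) + N / 16 ^ s)) / θ := by
    rw [le_div_iff₀ hθ]
    linarith
  calc 4 * 2 ^ s * 2 ^ t * E ≤ 4 * 2 ^ s * 2 ^ t * _ :=
        mul_le_mul_of_nonneg_left edges_le (by positivity)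
    _ = 16 * Real.exp 1 * p / D * ((4 ^ s * A.card) * (4 ^ t * B.card)) / θ +
      3 * (4 * 2 ^ s * 2 ^ t / θ * (B.card * (1 + 3 * t) + N / 16 ^ t)) +
      3 * (4 * 2 ^ s * 2 ^ t / θ * (A.card * (1 + 3 * s) + N / 16 ^ s)) := by
        rw [four_pow_eq, four_pow_eq, pow_add]
        field_simp
        ring
    _ ≤ _ := by
        gcongr
        exact div_le_self (by positivity) one_le_exponent

lemma product_term_le {p D N : ℝ} (hD : 0 < D) (hN : 0 ≤ N) (hpN : p * N = 2 * D ^ 2) :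
    16 * Real.exp 1 * p / D * ((16 * N) * (16 * N)) ≤ 22300 * D * N := by
  have exp_one_le : Real.exp 1 ≤ 2.72 := Real.exp_one_lt_d9.le.trans (by norm_num)
  calc 16 * Real.exp 1 * p / D * ((16 * N) * (16 * N))
      = 4096 * Real.exp 1 * N * ((p * N) / D) := by ring
    _ = 8192 * Real.exp 1 * (D * N) := by
        rw [hpN, show 2 * D ^ 2 / D = 2 * D by field_simp]; ring
    _ ≤ 8192 * 2.72 * (D * N) := by gcongr
    _ ≤ _ := by nlinarith [mul_nonneg hD.le hN]

lemma sum_sum_mul_fiberwise {ι κ : Type*} [DecidableEq κ] (S : Finset ι) (l : ι → κ)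
    (g : κ → κ → ℝ) (T : ι → ι → ℝ) :
    ∑ i ∈ S, ∑ j ∈ S, g (l i) (l j) * T i j =
      ∑ s ∈ S.image l, ∑ t ∈ S.image l,
        g s t * ∑ i ∈ S with l i = s, ∑ j ∈ S with l j = t, T i j := by
  have fiberwise (f : ι → ℝ) : ∑ i ∈ S, f i = ∑ s ∈ S.image l, ∑ i ∈ S with l i = s, f i :=
    (Finset.sum_fiberwise_of_maps_to (fun _ => Finset.mem_image_of_mem l) f).symm
  rw [fiberwise]
  refine Finset.sum_congr rfl fun s _ => ?_
  simp_rw [fiberwise (fun j => g _ (l j) * T _ j)]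
  rw [Finset.sum_comm]
  refine Finset.sum_congr rfl fun t _ => ?_
  simp_rw [Finset.mul_sum]
  refine Finset.sum_congr rfl fun i hi => Finset.sum_congr rfl fun j hj => ?_
  rw [(Finset.mem_filter.1 hi).2, (Finset.mem_filter.1 hj).2]

open Classical in
lemma ite_balanced_mul_sum_le {T : V → V → ℝ} {p D : ℝ} (hD : 0 < D) (hp : 0 ≤ p) {s t : ℕ}
    (hT : Discrepancy T p (levelExponent D (s + t))) {A B : Finset V} (hA : A.Nonempty)
    (hB : B.Nonempty) :
    (if Balanced D s t then 4 * 2 ^ s * 2 ^ t else 0) * (∑ i ∈ A, ∑ j ∈ B, T i j) ≤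
      16 * Real.exp 1 * p / D * ((4 ^ s * A.card) * (4 ^ t * B.card)) +
      (if Balanced D s t then levelCost D (Fintype.card V) B.card s t else 0) +
      (if Balanced D t s then levelCost D (Fintype.card V) A.card t s else 0) := by
  rw [if_congr (balanced_comm (s := t)) rfl rfl]
  split_ifs with hb
  · exact hb.mul_sum_le hD hp hT hA hB
  · rw [zero_mul, add_zero, add_zero]
    positivity

lemma two_pow_add_le_of_four_pow_le {X : ℝ} {s t : ℕ} (hs : 4 ^ s ≤ X) (ht : 4 ^ t ≤ X) :
    2 ^ (s + t) ≤ X := by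
  rw [four_pow_eq] at hs ht
  rw [pow_add]
  nlinarith [sq_nonneg ((2 : ℝ) ^ s - 2 ^ t)]

lemma sum_sum_mul_add_add_swap {ι : Type*} (F : Finset ι) (c : ℝ) (f : ι → ℝ) (R : ι → ι → ℝ) :
    ∑ s ∈ F, ∑ t ∈ F, (c * (f s * f t) + R s t + R t s) =
      c * ((∑ s ∈ F, f s) * ∑ s ∈ F, f s) + 2 * ∑ t ∈ F, ∑ s ∈ F, R s t := by
  simp only [Finset.sum_add_distrib]
  rw [Finset.sum_comm (f := fun s t => R s t), Finset.sum_mul_sum, Finset.mul_sum, two_mul,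
    ← add_assoc]
  simp only [Finset.mul_sum]

open Classical in
lemma sum_balanced_edges_le {T : V → V → ℝ} {p D : ℝ} (hD : 0 < D)
    (hpN : p * Fintype.card V = 2 * D ^ 2) (S : Finset V) (l : V → ℕ)
    (hl : ∑ i ∈ S, (4 : ℝ) ^ l i ≤ 16 * Fintype.card V)
    (hT : ∀ m : ℕ, (2 : ℝ) ^ m ≤ 16 * Fintype.card V → Discrepancy T p (levelExponent D m)) :
    ∑ i ∈ S, ∑ j ∈ S, (if Balanced D (l i) (l j) then 4 * 2 ^ l i * 2 ^ l j else 0) * T i j ≤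
      40000 * D * Fintype.card V := by
  have hN : (0 : ℝ) ≤ Fintype.card V := Nat.cast_nonneg _
  have hp : 0 ≤ p := (pos_and_pos_of_mul_eq_two_mul_sq hD hN hpN).1.le
  set I : ℕ → Finset V := fun s => S.filter fun i => l i = s
  have sum_mass_le : ∑ t ∈ S.image l, (4 : ℝ) ^ t * (I t).card ≤ 16 * Fintype.card V := by
    rw [Finset.sum_comp (fun s => (4 : ℝ) ^ s) l] at hl
    simpa only [nsmul_eq_mul, mul_comm] using hl
  have four_pow_le {s : ℕ} (hs : s ∈ S.image l) : (4 : ℝ) ^ s ≤ 16 * Fintype.card V := by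
    obtain ⟨i, hi, rfl⟩ := Finset.mem_image.1 hs
    exact (Finset.single_le_sum (f := fun i => (4 : ℝ) ^ l i) (fun _ _ => by positivity)
      hi).trans hl
  have nonempty {s : ℕ} (hs : s ∈ S.image l) : (I s).Nonempty :=
    Finset.fiber_nonempty_iff_mem_image.2 hs
  have cost_le := sum_balanced_levelCost_le hD hN (S.image l) (a := fun t => (I t).card)
    (fun _ => Nat.cast_nonneg _) sum_mass_le
  have product_le := product_term_le hD hN hpN
  simp only [Finset.sum_filter] at cost_le
  rw [sum_sum_mul_fiberwise S l fun s t => if Balanced D s t then 4 * 2 ^ s * 2 ^ t else 0]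
  set N : ℝ := (Fintype.card V : ℝ)
  calc _ ≤ ∑ s ∈ S.image l, ∑ t ∈ S.image l,
          (16 * Real.exp 1 * p / D * ((4 ^ s * (I s).card) * (4 ^ t * (I t).card)) +
          (if Balanced D s t then levelCost D N (I t).card s t else 0) +
          (if Balanced D t s then levelCost D N (I s).card t s else 0)) :=
        Finset.sum_le_sum fun s hs => Finset.sum_le_sum fun t ht =>
          ite_balanced_mul_sum_le hD hp
            (hT _ (two_pow_add_le_of_four_pow_le (four_pow_le hs) (four_pow_le ht)))
            (nonempty hs) (nonempty ht)
    _ = 16 * Real.exp 1 * p / D * ((∑ s ∈ S.image l, (4 : ℝ) ^ s * (I s).card) *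
            ∑ s ∈ S.image l, (4 : ℝ) ^ s * (I s).card) +
          2 * ∑ t ∈ S.image l, ∑ s ∈ S.image l,
            (if Balanced D s t then levelCost D N (I t).card s t else 0) :=
        sum_sum_mul_add_add_swap _ _ _ fun s t =>
          if Balanced D s t then levelCost D N (I t).card s t else 0
    _ ≤ 16 * Real.exp 1 * p / D * ((16 * N) * (16 * N)) + 2 * (6960 * D * N) := by
        refine add_le_add (mul_le_mul_of_nonneg_left ?_ (by positivity))
          (mul_le_mul_of_nonneg_left cost_le zero_le_two)
        exact mul_self_le_mul_self (Finset.sum_nonneg fun _ _ => by positivity) sum_mass_le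
    _ ≤ 40000 * D * N := by linarith [mul_nonneg hD.le hN]

end Discrepancy

section HeavyPairs

variable {V : Type*} [Fintype V]

/-- The dyadic level of an integer: `2 ^ level m ≤ |m| < 2 ^ (level m + 1)` for `m ≠ 0`, with
`level 0 = 0`. -/
def level (m : ℤ) : ℕ := Nat.log 2 m.natAbs

lemma two_pow_level_le_abs {m : ℤ} (hm : m ≠ 0) : (2 : ℝ) ^ level m ≤ |(m : ℝ)| := by
  have := Nat.pow_log_le_self 2 (Int.natAbs_ne_zero.2 hm)
  rw [← Int.cast_abs, Int.abs_eq_natAbs]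
  exact_mod_cast this

lemma abs_le_two_mul_two_pow_level (m : ℤ) : |(m : ℝ)| ≤ 2 * (2 : ℝ) ^ level m := by
  have := (Nat.lt_pow_succ_log_self (b := 2) (by norm_num) m.natAbs).le
  rw [← Int.cast_abs, Int.abs_eq_natAbs, ← pow_succ']
  exact_mod_cast this

lemma four_pow_level_le_sq {m : ℤ} (hm : m ≠ 0) : (4 : ℝ) ^ level m ≤ (m : ℝ) ^ 2 := by
  rw [four_pow_eq, ← sq, ← sq_abs (m : ℝ)]
  exact pow_le_pow_left₀ (by positivity) (two_pow_level_le_abs hm) 2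

lemma abs_mul_le_four_mul_two_pow (a b : ℤ) :
    |(a : ℝ) * b| ≤ 4 * 2 ^ level a * 2 ^ level b := by
  calc |(a : ℝ) * b| = |(a : ℝ)| * |(b : ℝ)| := abs_mul _ _
    _ ≤ (2 * 2 ^ level a) * (2 * 2 ^ level b) := by
        gcongr <;> exact abs_le_two_mul_two_pow_level _
    _ = _ := by ring

lemma mul_abs_le_of_mul_two_pow_level_le {D : ℝ} (hD : 0 < D) {a b : ℤ} (ha : a ≠ 0)
    (h : D * 2 ^ level b ≤ 2 ^ level a) : D * |(b : ℝ)| ≤ 2 * |(a : ℝ)| := by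
  calc D * |(b : ℝ)| ≤ D * (2 * 2 ^ level b) := by
        gcongr
        exact abs_le_two_mul_two_pow_level b
    _ = 2 * (D * 2 ^ level b) := by ring
    _ ≤ 2 * |(a : ℝ)| := by
        gcongr
        exact h.trans (two_pow_level_le_abs ha)

lemma balanced_or_dominated {D : ℝ} (hD : 0 < D) {a b : ℤ} (h : D < |(a : ℝ) * b|) :
    Balanced D (level a) (level b) ∨ D * |(b : ℝ)| ≤ 2 * |(a : ℝ)| ∨
      D * |(a : ℝ)| ≤ 2 * |(b : ℝ)| := by
  have hab : (a : ℝ) * b ≠ 0 := abs_pos.1 (hD.trans h)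
  have ha : a ≠ 0 := by exact_mod_cast left_ne_zero_of_mul hab
  have hb : b ≠ 0 := by exact_mod_cast right_ne_zero_of_mul hab
  by_cases hs : (2 : ℝ) ^ level a ≤ D * 2 ^ level b
  · by_cases ht : (2 : ℝ) ^ level b ≤ D * 2 ^ level a
    · refine Or.inl ⟨hs, ht, h.trans_le ?_⟩
      rw [pow_add, ← mul_assoc]
      exact abs_mul_le_four_mul_two_pow a b
    · exact Or.inr (Or.inr (mul_abs_le_of_mul_two_pow_level_le hD hb (not_le.1 ht).le))
  · exact Or.inr (Or.inl (mul_abs_le_of_mul_two_pow_level_le hD ha (not_le.1 hs).le))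

lemma abs_mul_le_of_mul_abs_le {D a b : ℝ} (hD : 0 < D) (h : D * |b| ≤ 2 * |a|) :
    |a * b| ≤ 2 / D * a ^ 2 := by
  have b_le : |b| ≤ 2 * |a| / D := by rwa [le_div_iff₀ hD, mul_comm]
  calc |a * b| = |a| * |b| := abs_mul a b
    _ ≤ |a| * (2 * |a| / D) := by gcongr
    _ = 2 / D * |a| ^ 2 := by ring
    _ = 2 / D * a ^ 2 := by rw [sq_abs]

open Classical in
lemma heavy_pair_le {D : ℝ} (hD : 0 < D) (a b : ℤ) :
    (if D < |(a : ℝ) * b| then |(a : ℝ) * b| else 0) ≤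
      2 / D * (a : ℝ) ^ 2 + 2 / D * (b : ℝ) ^ 2 +
      (if Balanced D (level a) (level b) then 4 * 2 ^ level a * 2 ^ level b else 0) := by
  have ha : 0 ≤ 2 / D * (a : ℝ) ^ 2 := by positivity
  have hb : 0 ≤ 2 / D * (b : ℝ) ^ 2 := by positivity
  have balanced_nonneg : (0 : ℝ) ≤
      if Balanced D (level a) (level b) then 4 * 2 ^ level a * 2 ^ level b else 0 := by positivity
  rcases lt_or_ge D |(a : ℝ) * b| with heavy | light
  · rw [if_pos heavy]
    rcases balanced_or_dominated hD heavy with bal | dom | dom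
    · rw [if_pos bal]
      linarith [abs_mul_le_four_mul_two_pow a b]
    · linarith [abs_mul_le_of_mul_abs_le hD dom]
    · rw [mul_comm (a : ℝ)]
      linarith [abs_mul_le_of_mul_abs_le hD dom]
  · rw [if_neg light.not_gt]
    positivity

/-- The part of the quadratic form of `W` at `z` coming from the light pairs, those with
`|z i * z j| ≤ D`. -/
def lightSum (D : ℝ) (z : V → ℤ) (W : V → V → ℝ) : ℝ :=
  ∑ i, ∑ j, (if |(z i : ℝ) * z j| ≤ D then (z i : ℝ) * z j else 0) * W i j

/-- The part of the quadratic form of `W` at `|z|` coming from the heavy pairs, those with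
`|z i * z j| > D`. -/
def heavySum (D : ℝ) (z : V → ℤ) (W : V → V → ℝ) : ℝ :=
  ∑ i, ∑ j, (if D < |(z i : ℝ) * z j| then |(z i : ℝ) * z j| else 0) * W i j

lemma sum_sum_sq_mul_le {ι : Type*} {S : Finset ι} {W : ι → ι → ℝ} {k : ℝ} (z : ι → ℝ)
    (hW : ∀ i ∈ S, ∑ j ∈ S, W i j ≤ k) :
    ∑ i ∈ S, ∑ j ∈ S, z i ^ 2 * W i j ≤ k * ∑ i ∈ S, z i ^ 2 := by
  rw [Finset.mul_sum]
  refine Finset.sum_le_sum fun i hi => ?_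
  rw [← Finset.mul_sum, mul_comm]
  exact mul_le_mul_of_nonneg_right (hW i hi) (sq_nonneg _)

lemma heavySum_eq_sum_support {D : ℝ} (hD : 0 ≤ D) (z : V → ℤ) (W : V → V → ℝ) :
    heavySum D z W = ∑ i with z i ≠ 0, ∑ j with z j ≠ 0,
      (if D < |(z i : ℝ) * z j| then |(z i : ℝ) * z j| else 0) * W i j := by
  have ne_zero {i j : V}
      (h : (if D < |(z i : ℝ) * z j| then |(z i : ℝ) * z j| else 0) * W i j ≠ 0) :
      z i ≠ 0 ∧ z j ≠ 0 := by
    constructor <;> rintro h0 <;> simp [h0, hD.not_gt] at h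
  have inner_eq (i : V) :=
    Finset.sum_filter_of_ne (s := Finset.univ) fun j _ h => (ne_zero (i := i) (j := j) h).2
  simp_rw [inner_eq]
  refine (Finset.sum_filter_of_ne fun i _ h => ?_).symm
  obtain ⟨j, -, hj⟩ := Finset.exists_ne_zero_of_sum_ne_zero h
  exact (ne_zero hj).1

lemma heavySum_le {T : V → V → ℝ} {p D : ℝ} (hT0 : ∀ i j, 0 ≤ T i j) (hD : 0 < D)
    (hpN : p * Fintype.card V = 2 * D ^ 2) {z : V → ℤ}
    (hz : ∑ i, (z i : ℝ) ^ 2 ≤ 16 * Fintype.card V)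
    (hrow : ∀ i, z i ≠ 0 → ∑ j, T i j ≤ 20 * D ^ 2)
    (hcol : ∀ j, z j ≠ 0 → ∑ i, T i j ≤ 20 * D ^ 2)
    (hT : ∀ m : ℕ, (2 : ℝ) ^ m ≤ 16 * Fintype.card V → Discrepancy T p (levelExponent D m)) :
    heavySum D z T ≤ 41280 * D * Fintype.card V := by
  classical
  rw [heavySum_eq_sum_support hD.le]
  set S := Finset.univ.filter fun i => z i ≠ 0
  have sum_sq_le : ∑ i ∈ S, (z i : ℝ) ^ 2 ≤ 16 * Fintype.card V :=
    (Finset.sum_le_univ_sum_of_nonneg fun _ => sq_nonneg _).trans hz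
  have rows_le : ∑ i ∈ S, ∑ j ∈ S, (z i : ℝ) ^ 2 * T i j ≤ 20 * D ^ 2 * (16 * Fintype.card V) := by
    refine (sum_sum_sq_mul_le (fun i => (z i : ℝ)) fun i hi => ?_).trans (by gcongr)
    exact (Finset.sum_le_univ_sum_of_nonneg (hT0 i)).trans (hrow i (Finset.mem_filter.1 hi).2)
  have cols_le : ∑ i ∈ S, ∑ j ∈ S, (z j : ℝ) ^ 2 * T i j ≤ 20 * D ^ 2 * (16 * Fintype.card V) := by
    rw [Finset.sum_comm]
    refine (sum_sum_sq_mul_le (W := fun j i => T i j) (fun j => (z j : ℝ)) fun j hj => ?_).trans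
      (by gcongr)
    exact (Finset.sum_le_univ_sum_of_nonneg fun i => hT0 i j).trans
      (hcol j (Finset.mem_filter.1 hj).2)
  have balanced_le := sum_balanced_edges_le hD hpN S (fun i => level (z i))
    ((Finset.sum_le_sum fun i hi => four_pow_level_le_sq (Finset.mem_filter.1 hi).2).trans
      sum_sq_le) hT
  calc _ ≤ ∑ i ∈ S, ∑ j ∈ S, (2 / D * (z i : ℝ) ^ 2 + 2 / D * (z j : ℝ) ^ 2 +
        (if Balanced D (level (z i)) (level (z j)) then
          4 * 2 ^ level (z i) * 2 ^ level (z j) else 0)) * T i j :=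
        Finset.sum_le_sum fun i _ => Finset.sum_le_sum fun j _ =>
          mul_le_mul_of_nonneg_right (heavy_pair_le hD (z i) (z j)) (hT0 i j)
    _ ≤ 2 / D * (20 * D ^ 2 * (16 * Fintype.card V)) +
        2 / D * (20 * D ^ 2 * (16 * Fintype.card V)) + 40000 * D * Fintype.card V := by
        simp only [add_mul, Finset.sum_add_distrib]
        simp only [mul_assoc (2 / D), ← Finset.mul_sum (a := 2 / D)]
        gcongr
    _ = _ := by field_simp; ring

lemma heavySum_le_of_le {t : V → V → ℝ} {p D : ℝ} (hD : 0 < D) (htp : ∀ i j, t i j ≤ p)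
    (hpN : p * Fintype.card V = 2 * D ^ 2) {z : V → ℤ}
    (hz : ∑ i, (z i : ℝ) ^ 2 ≤ 16 * Fintype.card V) :
    heavySum D z t ≤ 512 * D * Fintype.card V := by
  set N : ℝ := (Fintype.card V : ℝ)
  have hp := (pos_and_pos_of_mul_eq_two_mul_sq hD (Nat.cast_nonneg _) hpN).1
  have pair_le (i j : V) : (if D < |(z i : ℝ) * z j| then |(z i : ℝ) * z j| else 0) * t i j ≤
      p / D * ((z i : ℝ) ^ 2 * (z j : ℝ) ^ 2) := by
    split_ifs with h
    · calc |(z i : ℝ) * z j| * t i j ≤ |(z i : ℝ) * z j| * p := by gcongr; exact htp i j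
        _ ≤ |(z i : ℝ) * z j| * p * (|(z i : ℝ) * z j| / D) :=
            le_mul_of_one_le_right (by positivity) ((one_le_div hD).2 h.le)
        _ = p / D * |(z i : ℝ) * z j| ^ 2 := by ring
        _ = _ := by rw [sq_abs, mul_pow]
    · rw [zero_mul]
      positivity
  calc heavySum D z t ≤ ∑ i, ∑ j, p / D * ((z i : ℝ) ^ 2 * (z j : ℝ) ^ 2) :=
        Finset.sum_le_sum fun i _ => Finset.sum_le_sum fun j _ => pair_le i j
    _ = p / D * ((∑ i, (z i : ℝ) ^ 2) * ∑ i, (z i : ℝ) ^ 2) := by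
        simp only [← Finset.mul_sum, Finset.sum_mul_sum]
    _ ≤ p / D * ((16 * N) * (16 * N)) := by gcongr
    _ = (p * N) / D * 256 * N := by ring
    _ = _ := by rw [hpN]; field_simp; ring

lemma abs_quadratic_form_sub_lightSum_le {T t : V → V → ℝ} (hT : ∀ i j, 0 ≤ T i j)
    (ht : ∀ i j, 0 ≤ t i j) (D : ℝ) (z : V → ℤ) :
    |∑ i, ∑ j, (z i : ℝ) * z j * (T i j - t i j) - lightSum D z (fun i j => T i j - t i j)| ≤
      heavySum D z T + heavySum D z t := by
  simp only [lightSum, heavySum, ← Finset.sum_sub_distrib, ← Finset.sum_add_distrib]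
  refine (Finset.abs_sum_le_sum_abs _ _).trans <| Finset.sum_le_sum fun i _ =>
    (Finset.abs_sum_le_sum_abs _ _).trans <| Finset.sum_le_sum fun j _ => ?_
  rcases le_or_gt |(z i : ℝ) * z j| D with light | heavy
  · rw [if_pos light, if_neg light.not_gt, sub_self, abs_zero, zero_mul, zero_mul, add_zero]
  · rw [if_neg heavy.not_ge, if_pos heavy, zero_mul, sub_zero, abs_mul, ← mul_add]
    gcongr
    exact (abs_sub _ _).trans_eq (by rw [abs_of_nonneg (hT i j), abs_of_nonneg (ht i j)])

/-- On the light pairs, the quadratic form of `T - t` at integer vectors of squared length of order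
`card V` is of order `D * card V`. -/
def LightBound (T t : V → V → ℝ) (D : ℝ) : Prop :=
  ∀ z : V → ℤ, ∑ i, (z i : ℝ) ^ 2 ≤ 16 * Fintype.card V →
    |lightSum D z fun i j => T i j - t i j| ≤ 540 * D * Fintype.card V

/-- The properties of a random weighted graph `T` with mean `t` that the spectral norm bound uses:
the light-pair bound, and the discrepancy bound at all the exponents needed for the heavy pairs. -/
structure IsRegular (T t : V → V → ℝ) (p D : ℝ) : Prop where
  lightBound : LightBound T t D
  discrepancy_one : Discrepancy T p 1
  discrepancy : ∀ m : ℕ, (2 : ℝ) ^ m ≤ 16 * Fintype.card V → Discrepancy T p (levelExponent D m)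

theorem IsRegular.abs_quadratic_form_le {T t : V → V → ℝ} {p D : ℝ} (h : IsRegular T t p D)
    (hT : ∀ i j, 0 ≤ T i j) (ht : ∀ i j, t i j ∈ Set.Icc 0 p) (hD : 0 < D)
    (hpN : p * Fintype.card V = 2 * D ^ 2) {z : V → ℤ}
    (hz : ∑ i, (z i : ℝ) ^ 2 ≤ 16 * Fintype.card V)
    (hrow : ∀ i, z i ≠ 0 → ∑ j, T i j ≤ 20 * D ^ 2)
    (hcol : ∀ j, z j ≠ 0 → ∑ i, T i j ≤ 20 * D ^ 2) :
    |∑ i, ∑ j, (z i : ℝ) * z j * (T i j - t i j)| ≤ 42400 * D * Fintype.card V := by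
  have light_le := h.lightBound z hz
  have heavy_T := heavySum_le hT hD hpN hz hrow hcol h.discrepancy
  have heavy_t := heavySum_le_of_le hD (fun i j => (ht i j).2) hpN hz
  have heavy_le := abs_quadratic_form_sub_lightSum_le hT (fun i j => (ht i j).1) D z
  have := mul_nonneg hD.le (Nat.cast_nonneg (α := ℝ) (Fintype.card V))
  linarith [abs_sub_abs_le_abs_sub (∑ i, ∑ j, (z i : ℝ) * z j * (T i j - t i j))
    (lightSum D z fun i j => T i j - t i j)]

end HeavyPairs

section Trimming

variable {V : Type*}

open Classical in
/-- The vector `z` with its coordinates in `R` replaced by `0`. -/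
def zeroOut (R : Finset V) (z : V → ℤ) : V → ℤ := fun i => if i ∈ R then 0 else z i

lemma notMem_of_zeroOut_ne_zero {R : Finset V} {z : V → ℤ} {i : V} (h : zeroOut R z i ≠ 0) :
    i ∉ R := fun hi => h (if_pos hi)

variable [Fintype V]

open Classical in
/-- The vertices whose rows and columns `trim Y k` zeroes out. -/
def overloaded (Y : Matrix V V ℝ) (k : ℝ) : Finset V := Finset.univ.filter fun i => k < degree Y i

lemma mem_overloaded {Y : Matrix V V ℝ} {k : ℝ} {i : V} : i ∈ overloaded Y k ↔ k < degree Y i := by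
  simp [overloaded]

lemma sum_sq_zeroOut_le (R : Finset V) (z : V → ℤ) :
    ∑ i, (zeroOut R z i : ℝ) ^ 2 ≤ ∑ i, (z i : ℝ) ^ 2 := by
  refine Finset.sum_le_sum fun i _ => ?_
  unfold zeroOut
  split_ifs
  · rw [Int.cast_zero, zero_pow two_ne_zero]
    positivity
  · exact le_rfl

lemma mul_trim_apply (Y : Matrix V V ℝ) (k : ℝ) (z : V → ℤ) (i j : V) :
    (z i : ℝ) * z j * trim Y k i j =
      (zeroOut (overloaded Y k) z i : ℝ) * zeroOut (overloaded Y k) z j * Y i j := by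
  by_cases hi : k < degree Y i <;> by_cases hj : k < degree Y j <;>
    simp [trim, zeroOut, mem_overloaded, hi, hj]

lemma degree_eq_sum_add_sum {T : V → V → ℝ} {Y : Matrix V V ℝ}
    (hY : ∀ i j, Y i j = T i j + T j i) (i : V) : degree Y i = ∑ j, T i j + ∑ j, T j i := by
  rw [degree, ← Finset.sum_add_distrib]
  exact Finset.sum_congr rfl fun j _ => hY i j

lemma card_overloaded_le {T : V → V → ℝ} {Y : Matrix V V ℝ} (hY : ∀ i j, Y i j = T i j + T j i)
    {p D : ℝ} (hpN : p * Fintype.card V = 2 * D ^ 2) (hT : Discrepancy T p 1) :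
    D ^ 2 * (overloaded Y (20 * D ^ 2)).card ≤ 2 * Fintype.card V := by
  set R := overloaded Y (20 * D ^ 2)
  rcases R.eq_empty_or_nonempty with h | h
  · simp [h]
  have hR : (0 : ℝ) < R.card := by exact_mod_cast h.card_pos
  have univ_nonempty : (Finset.univ : Finset V).Nonempty := h.mono (Finset.subset_univ _)
  have hN : (0 : ℝ) < Fintype.card V := by
    exact_mod_cast h.card_pos.trans_le (Finset.card_le_univ R)
  have out_edges := hT R Finset.univ h univ_nonempty
  have in_edges := hT Finset.univ R univ_nonempty h
  rw [Finset.card_univ] at out_edges in_edges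
  have entropy_R := entropyWeight_le hN hR
  have entropy_univ := entropyWeight_le hN hN
  set N : ℝ := (Fintype.card V : ℝ)
  have degrees_ge : R.card * (20 * D ^ 2) ≤ ∑ i ∈ R, ∑ j, T i j + ∑ i, ∑ j ∈ R, T i j := by
    calc R.card * (20 * D ^ 2) ≤ ∑ i ∈ R, degree Y i := by
          rw [← nsmul_eq_mul]
          exact Finset.card_nsmul_le_sum _ _ _ fun i hi => (mem_overloaded.1 hi).le
      _ = _ := by
          simp only [degree_eq_sum_add_sum hY, Finset.sum_add_distrib]
          rw [Finset.sum_comm (s := Finset.univ) (t := R)]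
  have mean_le : p * N * R.card * Real.exp 1 ≤ 5.44 * (D ^ 2 * R.card) := by
    rw [hpN]
    nlinarith [Real.exp_one_lt_d9, show 0 ≤ D ^ 2 * R.card by positivity]
  rw [mul_right_comm p] at out_edges
  nlinarith

lemma sq_sum_abs_le_card_mul (z : V → ℤ) (R : Finset V) :
    (∑ i ∈ R, |(z i : ℝ)|) ^ 2 ≤ R.card * ∑ i, (z i : ℝ) ^ 2 := by
  calc (∑ i ∈ R, |(z i : ℝ)|) ^ 2 ≤ R.card * ∑ i ∈ R, |(z i : ℝ)| ^ 2 := sq_sum_le_card_mul_sum_sq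
    _ ≤ R.card * ∑ i, (z i : ℝ) ^ 2 := by
        simp only [sq_abs]
        gcongr
        exact Finset.subset_univ R

lemma sum_abs_le_four_mul_card {z : V → ℤ} (hz : ∑ i, (z i : ℝ) ^ 2 ≤ 16 * Fintype.card V) :
    ∑ i, |(z i : ℝ)| ≤ 4 * Fintype.card V := by
  refine abs_le_of_sq_le_sq' ?_ (by positivity) |>.2
  calc (∑ i, |(z i : ℝ)|) ^ 2 ≤ Fintype.card V * ∑ i, (z i : ℝ) ^ 2 :=
        sq_sum_abs_le_card_mul z Finset.univ
    _ ≤ Fintype.card V * (16 * Fintype.card V) := by gcongr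
    _ = _ := by ring

lemma sum_abs_le_of_sq_mul_card_le {D : ℝ} (hD : 0 < D) {R : Finset V}
    (hR : D ^ 2 * R.card ≤ 2 * Fintype.card V) {z : V → ℤ}
    (hz : ∑ i, (z i : ℝ) ^ 2 ≤ 16 * Fintype.card V) :
    ∑ i ∈ R, |(z i : ℝ)| ≤ 6 * Fintype.card V / D := by
  rw [le_div_iff₀ hD]
  refine abs_le_of_sq_le_sq' ?_ (by positivity) |>.2
  calc ((∑ i ∈ R, |(z i : ℝ)|) * D) ^ 2 = (∑ i ∈ R, |(z i : ℝ)|) ^ 2 * D ^ 2 := by ring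
    _ ≤ (R.card * (16 * Fintype.card V)) * D ^ 2 := by
        gcongr
        exact (sq_sum_abs_le_card_mul z R).trans (by gcongr)
    _ = (D ^ 2 * R.card) * (16 * Fintype.card V) := by ring
    _ ≤ (2 * Fintype.card V) * (16 * Fintype.card V) := by gcongr
    _ ≤ _ := by nlinarith [Nat.cast_nonneg (α := ℝ) (Fintype.card V)]

lemma abs_sum_sum_le {f g : V → V → ℝ} (h : ∀ i j, |f i j| ≤ g i j) :
    |∑ i, ∑ j, f i j| ≤ ∑ i, ∑ j, g i j :=
  (Finset.abs_sum_le_sum_abs _ _).trans <| Finset.sum_le_sum fun i _ =>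
    (Finset.abs_sum_le_sum_abs _ _).trans <| Finset.sum_le_sum fun j _ => h i j

lemma abs_sum_sum_sub_zeroOut_le {P : V → V → ℝ} {p : ℝ} (hP : ∀ i j, P i j ∈ Set.Icc 0 p)
    (R : Finset V) (z : V → ℤ) :
    |∑ i, ∑ j, ((z i : ℝ) * z j - zeroOut R z i * zeroOut R z j) * P i j| ≤
      2 * p * ((∑ i ∈ R, |(z i : ℝ)|) * ∑ i, |(z i : ℝ)|) := by
  classical
  set r : V → ℝ := fun i => if i ∈ R then |(z i : ℝ)| else 0
  have sum_r : ∑ i, r i = ∑ i ∈ R, |(z i : ℝ)| := by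
    rw [← Finset.sum_filter, Finset.filter_univ_mem]
  have pair_le (i j : V) : |(z i : ℝ) * z j - zeroOut R z i * zeroOut R z j| ≤
      r i * |(z j : ℝ)| + |(z i : ℝ)| * r j := by
    by_cases hi : i ∈ R <;> by_cases hj : j ∈ R <;> simp [r, zeroOut, hi, hj, abs_mul, mul_nonneg]
  calc _ ≤ ∑ i, ∑ j, (p * (r i * |(z j : ℝ)|) + p * (|(z i : ℝ)| * r j)) := by
        refine abs_sum_sum_le fun i j => ?_
        rw [abs_mul, abs_of_nonneg (hP i j).1, ← mul_add, mul_comm p]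
        exact mul_le_mul (pair_le i j) (hP i j).2 (hP i j).1 ((abs_nonneg _).trans (pair_le i j))
    _ = _ := by
        simp only [Finset.sum_add_distrib, ← Finset.mul_sum, ← Finset.sum_mul]
        rw [sum_r]
        ring

lemma abs_sum_sum_diagonal_le {W : V → V → ℝ} {c : ℝ} (hdiag : ∀ i, |W i i| ≤ c)
    (hoff : ∀ i j, i ≠ j → W i j = 0) (z : V → ℝ) :
    |∑ i, ∑ j, z i * z j * W i j| ≤ c * ∑ i, z i ^ 2 := by
  classical
  have diagonal_eq : ∑ i, ∑ j, z i * z j * W i j = ∑ i, z i ^ 2 * W i i := by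
    refine Finset.sum_congr rfl fun i _ => ?_
    rw [Finset.sum_eq_single i (fun j _ hj => by rw [hoff i j hj.symm, mul_zero])
      (fun hi => (hi (Finset.mem_univ i)).elim), sq]
  rw [diagonal_eq, Finset.mul_sum]
  refine (Finset.abs_sum_le_sum_abs _ _).trans (Finset.sum_le_sum fun i _ => ?_)
  rw [abs_mul, abs_of_nonneg (sq_nonneg (z i)), mul_comm]
  exact mul_le_mul_of_nonneg_right (hdiag i) (sq_nonneg _)

lemma trim_quadratic_form_eq {T t : V → V → ℝ} {Y P : Matrix V V ℝ}
    (hY : ∀ i j, Y i j = T i j + T j i) (k : ℝ) (z : V → ℤ) {w : V → ℤ}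
    (hw : w = zeroOut (overloaded Y k) z) :
    ∑ i, ∑ j, (z i : ℝ) * z j * (trim Y k i j - P i j) =
      2 * (∑ i, ∑ j, (w i : ℝ) * w j * (T i j - t i j)) -
      (∑ i, ∑ j, (w i : ℝ) * w j * (P i j - t i j - t j i)) -
      ∑ i, ∑ j, ((z i : ℝ) * z j - w i * w j) * P i j := by
  have swap : ∑ i, ∑ j, (w i : ℝ) * w j * (T j i - t j i) =
      ∑ i, ∑ j, (w i : ℝ) * w j * (T i j - t i j) := by
    rw [Finset.sum_comm]
    exact Finset.sum_congr rfl fun i _ => Finset.sum_congr rfl fun j _ => by ring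
  rw [two_mul]
  nth_rewrite 2 [← swap]
  simp only [← Finset.sum_add_distrib, ← Finset.sum_sub_distrib]
  refine Finset.sum_congr rfl fun i _ => Finset.sum_congr rfl fun j _ => ?_
  rw [mul_sub, mul_trim_apply, hY, hw]
  ring

lemma IsRegular.abs_zeroOut_overloaded_quadratic_form_le {T t : V → V → ℝ} {p D : ℝ}
    (h : IsRegular T t p D) {Y : Matrix V V ℝ} (hY : ∀ i j, Y i j = T i j + T j i)
    (hT : ∀ i j, 0 ≤ T i j) (ht : ∀ i j, t i j ∈ Set.Icc 0 p) (hD : 0 < D)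
    (hpN : p * Fintype.card V = 2 * D ^ 2) {z w : V → ℤ}
    (hz : ∑ i, (z i : ℝ) ^ 2 ≤ 16 * Fintype.card V)
    (hw : w = zeroOut (overloaded Y (20 * D ^ 2)) z) :
    |∑ i, ∑ j, (w i : ℝ) * w j * (T i j - t i j)| ≤ 42400 * D * Fintype.card V := by
  have row_add_col_le {i : V} (hi : w i ≠ 0) : ∑ j, T i j + ∑ j, T j i ≤ 20 * D ^ 2 := by
    rw [← degree_eq_sum_add_sum hY]
    rw [hw] at hi
    exact not_lt.1 (mem_overloaded.not.1 (notMem_of_zeroOut_ne_zero hi))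
  exact h.abs_quadratic_form_le hT ht hD hpN (hw ▸ (sum_sq_zeroOut_le _ z).trans hz)
    (fun i hi => (le_add_of_nonneg_right (Finset.sum_nonneg fun j _ => hT j i)).trans
      (row_add_col_le hi))
    (fun i hi => (le_add_of_nonneg_left (Finset.sum_nonneg fun j _ => hT i j)).trans
      (row_add_col_le hi))

theorem IsRegular.abs_trim_quadratic_form_le {T t : V → V → ℝ} {p D : ℝ}
    (h : IsRegular T t p D) {Y P : Matrix V V ℝ} (hY : ∀ i j, Y i j = T i j + T j i)
    (hT : ∀ i j, 0 ≤ T i j) (ht : ∀ i j, t i j ∈ Set.Icc 0 p) (htd : ∀ i, t i i = 0)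
    (hP : ∀ i j, P i j ∈ Set.Icc 0 p) (hPt : ∀ i j, i ≠ j → P i j = t i j + t j i)
    (hD : 0 < D) (hpD : p ≤ D) (hpN : p * Fintype.card V = 2 * D ^ 2) {z : V → ℤ}
    (hz : ∑ i, (z i : ℝ) ^ 2 ≤ 16 * Fintype.card V) :
    |∑ i, ∑ j, (z i : ℝ) * z j * (trim Y (20 * D ^ 2) i j - P i j)| ≤
      85000 * D * Fintype.card V := by
  obtain ⟨w, hw⟩ : ∃ w, w = zeroOut (overloaded Y (20 * D ^ 2)) z := ⟨_, rfl⟩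
  have centered_le := h.abs_zeroOut_overloaded_quadratic_form_le hY hT ht hD hpN hz hw
  have diagonal_le : |∑ i, ∑ j, (w i : ℝ) * w j * (P i j - t i j - t j i)| ≤
      D * (16 * Fintype.card V) := by
    refine (abs_sum_sum_diagonal_le (W := fun i j => P i j - t i j - t j i) (c := D)
      (fun i => ?_) (fun i j hij => ?_) fun i => (w i : ℝ)).trans ?_
    · rw [htd, sub_zero, sub_zero, abs_of_nonneg (hP i i).1]
      exact (hP i i).2.trans hpD
    · rw [hPt i j hij]
      ring
    · gcongr
      exact hw ▸ (sum_sq_zeroOut_le _ z).trans hz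
  have removed_le : |∑ i, ∑ j, ((z i : ℝ) * z j - w i * w j) * P i j| ≤
      96 * D * Fintype.card V := by
    have hp := (pos_and_pos_of_mul_eq_two_mul_sq hD (Nat.cast_nonneg _) hpN).1
    rw [hw]
    calc _ ≤ 2 * p * (6 * Fintype.card V / D * (4 * Fintype.card V)) := by
          refine (abs_sum_sum_sub_zeroOut_le hP _ z).trans ?_
          gcongr
          · exact sum_abs_le_of_sq_mul_card_le hD (card_overloaded_le hY hpN h.discrepancy_one) hz
          · exact sum_abs_le_four_mul_card hz
      _ = 48 * (p * Fintype.card V) / D * Fintype.card V := by ring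
      _ = _ := by rw [hpN]; field_simp; ring
  rw [trim_quadratic_form_eq hY _ z hw (t := t)]
  refine (abs_sub _ _).trans (le_trans (add_le_add (abs_sub _ _) le_rfl) ?_)
  rw [abs_mul, abs_two]
  linarith [mul_nonneg hD.le (Nat.cast_nonneg (α := ℝ) (Fintype.card V))]

end Trimming

section Chernoff

variable {V : Type*} [Fintype V] {Ω : Type*} [MeasurableSpace Ω] {μ : Measure Ω}
  {T : Ω → V → V → ℝ} {t : V → V → ℝ}

/-- The exponential moments of linear combinations of the `T i j` are at most those of independent
Poisson variables with means `t i j`, in the form that Chernoff bounds use. -/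
def ExpMomentBound (μ : Measure Ω) (T : Ω → V → V → ℝ) (t : V → V → ℝ) : Prop :=
  ∀ c : V → V → ℝ, Integrable (fun ω => Real.exp (∑ i, ∑ j, c i j * T ω i j)) μ ∧
    ∫ ω, Real.exp (∑ i, ∑ j, c i j * T ω i j) ∂μ ≤
      Real.exp (∑ i, ∑ j, t i j * (Real.exp (c i j) - 1))

lemma ExpMomentBound.chernoff (h : ExpMomentBound μ T t) (c : V → V → ℝ) (K : ℝ) :
    μ.real {ω | K ≤ ∑ i, ∑ j, c i j * T ω i j} ≤
      Real.exp (∑ i, ∑ j, t i j * (Real.exp (c i j) - 1) - K) := by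
  have markov := mul_meas_ge_le_integral_of_nonneg (μ := μ)
    (Eventually.of_forall fun ω => (Real.exp_pos (∑ i, ∑ j, c i j * T ω i j)).le) (h c).1
    (Real.exp K)
  simp only [Real.exp_le_exp] at markov
  rw [Real.exp_sub, le_div_iff₀ (Real.exp_pos K), mul_comm]
  exact markov.trans (h c).2

lemma ExpMomentBound.bernstein (h : ExpMomentBound μ T t) {p : ℝ}
    (ht : ∀ i j, t i j ∈ Set.Icc 0 p) {c : V → V → ℝ} (hc : ∀ i j, |c i j| ≤ 1) (K : ℝ) :
    μ.real {ω | K ≤ ∑ i, ∑ j, c i j * (T ω i j - t i j)} ≤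
      Real.exp (p * ∑ i, ∑ j, c i j ^ 2 - K) := by
  have event_eq : {ω | K ≤ ∑ i, ∑ j, c i j * (T ω i j - t i j)} =
      {ω | K + ∑ i, ∑ j, c i j * t i j ≤ ∑ i, ∑ j, c i j * T ω i j} := by
    simp only [mul_sub, Finset.sum_sub_distrib, le_sub_iff_add_le]
  have second_order (i j : V) :
      t i j * (Real.exp (c i j) - 1) ≤ c i j * t i j + p * c i j ^ 2 := by
    have taylor := (abs_le.1 (Real.abs_exp_sub_one_sub_id_le (hc i j))).2
    linarith [mul_le_mul_of_nonneg_left taylor (ht i j).1,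
      mul_le_mul_of_nonneg_right (ht i j).2 (sq_nonneg (c i j))]
  rw [event_eq]
  refine (h.chernoff c _).trans (Real.exp_le_exp.2 ?_)
  have sum_le := Finset.sum_le_sum fun i (_ : i ∈ Finset.univ) =>
    Finset.sum_le_sum fun j (_ : j ∈ Finset.univ) => second_order i j
  simp only [Finset.sum_add_distrib, ← Finset.mul_sum] at sum_le
  linarith

lemma ExpMomentBound.abs_bernstein (h : ExpMomentBound μ T t) {p : ℝ}
    (ht : ∀ i j, t i j ∈ Set.Icc 0 p) {c : V → V → ℝ} (hc : ∀ i j, |c i j| ≤ 1) (K : ℝ) :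
    μ.real {ω | K ≤ |∑ i, ∑ j, c i j * (T ω i j - t i j)|} ≤
      2 * Real.exp (p * ∑ i, ∑ j, c i j ^ 2 - K) := by
  have upper := h.bernstein ht hc K
  have lower := h.bernstein ht (c := fun i j => -c i j) (fun i j => (abs_neg _).trans_le (hc i j)) K
  simp only [neg_mul, Finset.sum_neg_distrib, neg_sq] at lower
  simp only [le_abs, Set.ofPred_or]
  exact (measureReal_union_le _ _).trans (by linarith)

lemma sum_sum_ite_mem_mul [DecidableEq V] (A B : Finset V) (θ : ℝ) (W : V → V → ℝ) :
    ∑ i, ∑ j, (if i ∈ A ∧ j ∈ B then θ else 0) * W i j = (∑ i ∈ A, ∑ j ∈ B, W i j) * θ := by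
  simp [ite_and, ite_mul, Finset.sum_ite_irrel, Finset.sum_mul, mul_comm θ]

lemma ExpMomentBound.measure_sum_sum_ge_le (h : ExpMomentBound μ T t) {p : ℝ}
    (ht : ∀ i j, t i j ∈ Set.Icc 0 p) (A B : Finset V) (θ K : ℝ) :
    μ.real {ω | K ≤ (∑ i ∈ A, ∑ j ∈ B, T ω i j) * θ} ≤
      Real.exp (p * A.card * B.card * Real.exp θ - K) := by
  classical
  have chernoff := h.chernoff (fun i j => if i ∈ A ∧ j ∈ B then θ else 0) K
  simp only [sum_sum_ite_mem_mul] at chernoff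
  refine chernoff.trans (Real.exp_le_exp.2 (sub_le_sub_right ?_ K))
  calc _ ≤ ∑ i, ∑ j, (if i ∈ A ∧ j ∈ B then Real.exp θ else 0) * p := by
        refine Finset.sum_le_sum fun i _ => Finset.sum_le_sum fun j _ => ?_
        split_ifs
        · nlinarith [(ht i j).1, mul_le_mul_of_nonneg_right (ht i j).2 (Real.exp_pos θ).le]
        · simp
    _ = p * A.card * B.card * Real.exp θ := by
        rw [sum_sum_ite_mem_mul]
        simp only [Finset.sum_const, nsmul_eq_mul]
        ring

lemma choose_le_exp_entropyWeight {N a : ℕ} (ha : 0 < a) (haN : a ≤ N) :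
    (N.choose a : ℝ) ≤ Real.exp (entropyWeight N a) := by
  have ha' : (0 : ℝ) < a := by exact_mod_cast ha
  have hN' : (0 : ℝ) < N := by exact_mod_cast ha.trans_le haN
  calc (N.choose a : ℝ) ≤ (N : ℝ) ^ a / a.factorial := Nat.choose_le_pow_div a N
    _ = ((a : ℝ) ^ a / a.factorial) * (N / a) ^ a := by rw [div_pow]; field_simp
    _ ≤ Real.exp a * (N / a) ^ a := by
        gcongr
        exact Real.pow_div_factorial_le_exp _ ha'.le _
    _ = _ := by
        rw [entropyWeight, mul_add, mul_one, Real.exp_add, ← Real.log_pow,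
          Real.exp_log (by positivity)]

lemma log_le_entropyWeight {N a : ℝ} (ha : 1 ≤ a) (haN : a ≤ N) :
    Real.log N ≤ entropyWeight N a := by
  have ha' : 0 < a := zero_lt_one.trans_le ha
  have log_a_le := Real.log_le_sub_one_of_pos ha'
  have log_le_log : Real.log a ≤ Real.log N := Real.log_le_log ha' haN
  rw [entropyWeight, Real.log_div (ha'.trans_le haN).ne' ha'.ne']
  nlinarith [mul_nonneg (sub_nonneg.2 ha) (sub_nonneg.2 log_le_log)]

lemma choose_mul_exp_neg_entropyWeight_le {N a : ℕ} (ha : 0 < a) (haN : a ≤ N) :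
    (N.choose a : ℝ) * Real.exp (-(3 * entropyWeight N a)) ≤ ((N : ℝ) ^ 2)⁻¹ := by
  have hN : (0 : ℝ) < N := by exact_mod_cast ha.trans_le haN
  have log_le : Real.log N ≤ entropyWeight N a :=
    log_le_entropyWeight (by exact_mod_cast ha) (by exact_mod_cast haN)
  calc (N.choose a : ℝ) * Real.exp (-(3 * entropyWeight N a))
      ≤ Real.exp (entropyWeight N a) * Real.exp (-(3 * entropyWeight N a)) := by
        gcongr
        exact choose_le_exp_entropyWeight ha haN
    _ = Real.exp (-(2 * entropyWeight N a)) := by rw [← Real.exp_add]; ring_nf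
    _ ≤ Real.exp (-(2 * Real.log N)) := by gcongr
    _ = _ := by rw [Real.exp_neg, two_mul, Real.exp_add, Real.exp_log hN, sq]

lemma sum_exp_neg_entropyWeight_le (V : Type*) [Fintype V] :
    ∑ A : Finset V with A.Nonempty, Real.exp (-(3 * entropyWeight (Fintype.card V) A.card)) ≤
      (Fintype.card V : ℝ)⁻¹ := by
  classical
  set N := Fintype.card V
  have sum_by_card := Finset.sum_powerset_apply_card (x := (Finset.univ : Finset V))
    (fun m => if m = 0 then (0 : ℝ) else Real.exp (-(3 * entropyWeight N m)))
  rw [Finset.powerset_univ, Finset.card_univ, Finset.sum_range_succ', if_pos rfl, smul_zero,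
    add_zero] at sum_by_card
  calc _ = ∑ A : Finset V, (if A.card = 0 then (0 : ℝ) else
        Real.exp (-(3 * entropyWeight N A.card))) := by
        simp only [Finset.sum_filter, Finset.nonempty_iff_ne_empty, ← Finset.card_eq_zero, ite_not]
    _ ≤ ∑ m ∈ Finset.range N, ((N : ℝ) ^ 2)⁻¹ := by
        rw [sum_by_card]
        refine Finset.sum_le_sum fun m hm => ?_
        rw [if_neg m.succ_ne_zero, nsmul_eq_mul]
        exact choose_mul_exp_neg_entropyWeight_le m.succ_pos (Finset.mem_range.1 hm)
    _ = N * ((N : ℝ) ^ 2)⁻¹ := by rw [Finset.sum_const, Finset.card_range, nsmul_eq_mul]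
    _ = _ := by rcases N.eq_zero_or_pos with h0 | h0 <;> [simp [h0]; field_simp]

theorem ExpMomentBound.measure_not_discrepancy_le [IsFiniteMeasure μ] (h : ExpMomentBound μ T t)
    {p : ℝ} (ht : ∀ i j, t i j ∈ Set.Icc 0 p) (θ : ℝ) :
    μ.real {ω | ¬ Discrepancy (T ω) p θ} ≤ ((Fintype.card V : ℝ) ^ 2)⁻¹ := by
  classical
  set nonemptySets : Finset (Finset V) := Finset.univ.filter fun A => A.Nonempty
  set w : Finset V → ℝ := fun A => 3 * entropyWeight (Fintype.card V) A.card
  set E : Finset V → Finset V → Set Ω := fun A B =>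
    {ω | p * A.card * B.card * Real.exp θ + w A + w B ≤ (∑ i ∈ A, ∑ j ∈ B, T ω i j) * θ}
  have measure_E_le (A B : Finset V) : μ.real (E A B) ≤ Real.exp (-w A) * Real.exp (-w B) := by
    rw [← Real.exp_add]
    refine (h.measure_sum_sum_ge_le ht A B θ _).trans_eq (congrArg Real.exp ?_)
    ring
  have subset_union : {ω | ¬ Discrepancy (T ω) p θ} ⊆
      ⋃ A ∈ nonemptySets, ⋃ B ∈ nonemptySets, E A B := by
    intro ω hω
    simp only [Set.mem_ofPred_eq, Discrepancy] at hω
    push Not at hω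
    obtain ⟨A, B, hA, hB, hAB⟩ := hω
    simp only [Set.mem_iUnion]
    exact ⟨A, by simpa [nonemptySets] using hA, B, by simpa [nonemptySets] using hB, hAB.le⟩
  calc μ.real {ω | ¬ Discrepancy (T ω) p θ}
      ≤ μ.real (⋃ A ∈ nonemptySets, ⋃ B ∈ nonemptySets, E A B) :=
        measureReal_mono subset_union (measure_ne_top _ _)
    _ ≤ ∑ A ∈ nonemptySets, ∑ B ∈ nonemptySets, μ.real (E A B) :=
        (measureReal_biUnion_finset_le _ _).trans
          (Finset.sum_le_sum fun A _ => measureReal_biUnion_finset_le _ _)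
    _ ≤ ∑ A ∈ nonemptySets, ∑ B ∈ nonemptySets, Real.exp (-w A) * Real.exp (-w B) :=
        Finset.sum_le_sum fun A _ => Finset.sum_le_sum fun B _ => measure_E_le A B
    _ = (∑ A ∈ nonemptySets, Real.exp (-w A)) * ∑ A ∈ nonemptySets, Real.exp (-w A) := by
        rw [Finset.sum_mul_sum]
    _ ≤ (Fintype.card V : ℝ)⁻¹ * (Fintype.card V : ℝ)⁻¹ := by
        have := sum_exp_neg_entropyWeight_le V
        gcongr
    _ = _ := by rw [← mul_inv, sq]

end Chernoff

section RandomRegularity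

variable {V : Type*} [Fintype V]

lemma sum_half_pow_natAbs_le (B : ℕ) :
    ∑ k ∈ Finset.Icc (-(B : ℤ)) B, ((1 : ℝ) / 2) ^ k.natAbs ≤ 3 - 2 * (1 / 2) ^ B := by
  induction B with
  | zero => norm_num
  | succ B ih =>
    have Icc_succ : Finset.Icc (-((B + 1 : ℕ) : ℤ)) ((B + 1 : ℕ) : ℤ) =
        insert ((B + 1 : ℕ) : ℤ) (insert (-((B + 1 : ℕ) : ℤ)) (Finset.Icc (-(B : ℤ)) B)) := by
      ext k
      simp only [Finset.mem_insert, Finset.mem_Icc]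
      omega
    rw [Icc_succ, Finset.sum_insert, Finset.sum_insert, Int.natAbs_neg, Int.natAbs_natCast,
      pow_succ]
    · linarith
    · simp only [Finset.mem_Icc]; omega
    · simp only [Finset.mem_insert, Finset.mem_Icc]; omega

lemma exp_neg_sq_le (k : ℤ) : Real.exp (-((k : ℝ) ^ 2)) ≤ (1 / 2) ^ k.natAbs := by
  have abs_le_sq : (k.natAbs : ℝ) ≤ (k : ℝ) ^ 2 := by
    rw [Nat.cast_natAbs]
    exact_mod_cast (Int.le_self_sq |k|).trans_eq (sq_abs k)
  calc Real.exp (-((k : ℝ) ^ 2)) ≤ Real.exp (k.natAbs * (-1)) := by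
        rw [Real.exp_le_exp]
        linarith
    _ = Real.exp (-1) ^ k.natAbs := Real.exp_nat_mul _ _
    _ ≤ _ := by
        gcongr
        linarith [Real.exp_neg_one_lt_d9]

/-- The integer vectors of squared length at most `16 * card V`, a net for the quadratic forms of
matrices on `V`; the box in the definition makes the set visibly finite. -/
def latticeBall (V : Type*) [Fintype V] : Finset (V → ℤ) :=
  open Classical in
  (Fintype.piFinset fun _ : V =>
    Finset.Icc (-((16 * Fintype.card V : ℕ) : ℤ)) ((16 * Fintype.card V : ℕ) : ℤ)).filter
    fun z => ∑ i, (z i : ℝ) ^ 2 ≤ 16 * Fintype.card V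

lemma mem_latticeBall {z : V → ℤ} :
    z ∈ latticeBall V ↔ ∑ i, (z i : ℝ) ^ 2 ≤ 16 * Fintype.card V := by
  classical
  refine ⟨fun h => (Finset.mem_filter.1 h).2, fun h => Finset.mem_filter.2 ⟨?_, h⟩⟩
  rw [Fintype.mem_piFinset]
  intro i
  have sq_le : (z i : ℝ) ^ 2 ≤ 16 * Fintype.card V :=
    (Finset.single_le_sum (f := fun i => (z i : ℝ) ^ 2) (fun _ _ => sq_nonneg _)
      (Finset.mem_univ i)).trans h
  rw [Finset.mem_Icc, ← abs_le]
  exact ((Int.le_self_sq |z i|).trans_eq (sq_abs _)).trans (by exact_mod_cast sq_le)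

lemma card_latticeBall_le (V : Type*) [Fintype V] :
    ((latticeBall V).card : ℝ) ≤ Real.exp (18 * Fintype.card V) := by
  classical
  set N : ℝ := (Fintype.card V : ℝ)
  set box := Finset.Icc (-((16 * Fintype.card V : ℕ) : ℤ)) ((16 * Fintype.card V : ℕ) : ℤ)
  have sum_box_le : ∑ k ∈ box, Real.exp (-((k : ℝ) ^ 2)) ≤ Real.exp 2 := by
    have : (0 : ℝ) < (1 / 2) ^ (16 * Fintype.card V) := by positivity
    linarith [(Finset.sum_le_sum fun k (_ : k ∈ box) => exp_neg_sq_le k).trans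
      (sum_half_pow_natAbs_le _), Real.add_one_le_exp 2]
  calc ((latticeBall V).card : ℝ) = ∑ _ ∈ latticeBall V, (1 : ℝ) := by simp
    _ ≤ ∑ z ∈ latticeBall V, Real.exp (16 * N) * ∏ i, Real.exp (-((z i : ℝ) ^ 2)) := by
        refine Finset.sum_le_sum fun z hz => ?_
        rw [← Real.exp_sum, ← Real.exp_add, Finset.sum_neg_distrib]
        exact Real.one_le_exp (by linarith [mem_latticeBall.1 hz])
    _ ≤ ∑ z ∈ Fintype.piFinset fun _ : V => box,
          Real.exp (16 * N) * ∏ i, Real.exp (-((z i : ℝ) ^ 2)) :=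
        Finset.sum_le_sum_of_subset_of_nonneg (Finset.filter_subset _ _) fun _ _ _ => by positivity
    _ = Real.exp (16 * N) * ∏ _i : V, ∑ k ∈ box, Real.exp (-((k : ℝ) ^ 2)) := by
        rw [Finset.prod_univ_sum, Finset.mul_sum]
    _ ≤ Real.exp (16 * N) * ∏ _i : V, Real.exp 2 := by gcongr
    _ = _ := by
        rw [Finset.prod_const, Finset.card_univ, ← Real.exp_nat_mul, ← Real.exp_add]
        congr 1
        ring

variable {Ω : Type*} [MeasurableSpace Ω] {μ : Measure Ω} {T : Ω → V → V → ℝ} {t : V → V → ℝ}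
  {p D : ℝ}

lemma ExpMomentBound.measure_lightSum_gt_le [IsFiniteMeasure μ] (h : ExpMomentBound μ T t)
    (ht : ∀ i j, t i j ∈ Set.Icc 0 p) (hD : 0 < D) (hpN : p * Fintype.card V = 2 * D ^ 2)
    {z : V → ℤ} (hz : ∑ i, (z i : ℝ) ^ 2 ≤ 16 * Fintype.card V) :
    μ.real {ω | 540 * D * Fintype.card V < |lightSum D z fun i j => T ω i j - t i j|} ≤
      2 * Real.exp (-(28 * Fintype.card V)) := by
  set N : ℝ := (Fintype.card V : ℝ)
  have hp := (pos_and_pos_of_mul_eq_two_mul_sq hD (Nat.cast_nonneg _) hpN).1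
  set c : V → V → ℝ := fun i j => (if |(z i : ℝ) * z j| ≤ D then (z i : ℝ) * z j else 0) / D
  have abs_c_le (i j : V) : |c i j| ≤ 1 := by
    rw [abs_div, abs_of_pos hD, div_le_one hD]
    split_ifs with light
    · exact light
    · simpa using hD.le
  have c_sq_le (i j : V) : c i j ^ 2 ≤ (z i : ℝ) ^ 2 * (z j : ℝ) ^ 2 / D ^ 2 := by
    simp only [c, div_pow]
    split_ifs
    · rw [mul_pow]
    · rw [zero_pow two_ne_zero, zero_div]
      positivity
  have sum_c_eq (W : V → V → ℝ) : ∑ i, ∑ j, c i j * W i j = lightSum D z W / D := by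
    simp only [lightSum, c, Finset.sum_div, div_mul_eq_mul_div]
  have variance_le : p * ∑ i, ∑ j, c i j ^ 2 ≤ 512 * N := by
    calc p * ∑ i, ∑ j, c i j ^ 2
        ≤ p * ∑ i, ∑ j, (z i : ℝ) ^ 2 * (z j : ℝ) ^ 2 / D ^ 2 := by
          gcongr
          exact c_sq_le _ _
      _ = p * ((∑ i, (z i : ℝ) ^ 2) * ∑ i, (z i : ℝ) ^ 2) / D ^ 2 := by
          simp only [← Finset.sum_div, Finset.sum_mul_sum]
          rw [mul_div_assoc]
      _ ≤ p * ((16 * N) * (16 * N)) / D ^ 2 := by gcongr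
      _ = (p * N) / D ^ 2 * 256 * N := by ring
      _ = _ := by rw [hpN]; field_simp; ring
  have tail := h.abs_bernstein ht abs_c_le (540 * N)
  simp only [sum_c_eq fun i j => T _ i j - t i j, abs_div, abs_of_pos hD, le_div_iff₀ hD] at tail
  calc _ ≤ _ := measureReal_mono (fun ω hω => ?_) (measure_ne_top _ _)
    _ ≤ _ := tail
    _ ≤ _ := by
        gcongr
        linarith
  exact (mul_right_comm 540 N D).trans_le (le_of_lt hω)

theorem ExpMomentBound.measure_not_lightBound_le [IsFiniteMeasure μ] (h : ExpMomentBound μ T t)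
    (ht : ∀ i j, t i j ∈ Set.Icc 0 p) (hD : 0 < D) (hpN : p * Fintype.card V = 2 * D ^ 2) :
    μ.real {ω | ¬ LightBound (T ω) t D} ≤ Real.exp (-(Fintype.card V : ℝ)) := by
  have one_le_card : (1 : ℝ) ≤ Fintype.card V := by
    exact_mod_cast (pos_and_pos_of_mul_eq_two_mul_sq hD (Nat.cast_nonneg _) hpN).2
  set N : ℝ := (Fintype.card V : ℝ)
  have eq_union : {ω | ¬ LightBound (T ω) t D} =
      ⋃ z ∈ latticeBall V, {ω | 540 * D * N < |lightSum D z fun i j => T ω i j - t i j|} := by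
    ext ω
    simp [LightBound, mem_latticeBall, N]
  calc μ.real {ω | ¬ LightBound (T ω) t D}
      ≤ ∑ z ∈ latticeBall V,
          μ.real {ω | 540 * D * N < |lightSum D z fun i j => T ω i j - t i j|} := by
        rw [eq_union]
        exact measureReal_biUnion_finset_le _ _
    _ ≤ ∑ z ∈ latticeBall V, 2 * Real.exp (-(28 * N)) :=
        Finset.sum_le_sum fun z hz => h.measure_lightSum_gt_le ht hD hpN (mem_latticeBall.1 hz)
    _ = (latticeBall V).card * (2 * Real.exp (-(28 * N))) := by
        rw [Finset.sum_const, nsmul_eq_mul]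
    _ ≤ Real.exp (18 * N) * (Real.exp (9 * N) * Real.exp (-(28 * N))) := by
        gcongr
        · exact card_latticeBall_le V
        · linarith [Real.add_one_le_exp (9 * N)]
    _ = _ := by rw [← Real.exp_add, ← Real.exp_add]; ring_nf

theorem ExpMomentBound.measure_not_isRegular_le [IsFiniteMeasure μ] (h : ExpMomentBound μ T t)
    (ht : ∀ i j, t i j ∈ Set.Icc 0 p) (hD : 0 < D) (hpN : p * Fintype.card V = 2 * D ^ 2) :
    μ.real {ω | ¬ IsRegular (T ω) t p D} ≤ 18 / Fintype.card V := by
  have one_le_card : (1 : ℝ) ≤ Fintype.card V := by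
    exact_mod_cast (pos_and_pos_of_mul_eq_two_mul_sq hD (Nat.cast_nonneg _) hpN).2
  have light_le := h.measure_not_lightBound_le ht hD hpN
  have discrepancy_le := h.measure_not_discrepancy_le ht
  set N := Fintype.card V
  set bad : ℝ → Set Ω := fun θ => {ω | ¬ Discrepancy (T ω) p θ}
  have subset_union : {ω | ¬ IsRegular (T ω) t p D} ⊆ {ω | ¬ LightBound (T ω) t D} ∪
      (bad 1 ∪ ⋃ m ∈ Finset.range (16 * N), bad (levelExponent D m)) := by
    intro ω hω
    by_contra good
    simp only [Set.mem_union, not_or, Set.mem_iUnion, not_exists, bad, Set.mem_ofPred_eq,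
      not_not] at good
    refine hω ⟨good.1, good.2.1, fun m hm => good.2.2 m (Finset.mem_range.2 ?_)⟩
    exact Nat.lt_two_pow_self.trans_le (by exact_mod_cast hm)
  have exp_le : Real.exp (-(N : ℝ)) ≤ 1 / N := by
    rw [Real.exp_neg, one_div]
    gcongr
    linarith [Real.add_one_le_exp (N : ℝ)]
  have inv_sq_le : ((N : ℝ) ^ 2)⁻¹ ≤ 1 / N := by
    rw [one_div]
    gcongr
    exact le_self_pow₀ one_le_card two_ne_zero
  calc μ.real {ω | ¬ IsRegular (T ω) t p D}
      ≤ μ.real {ω | ¬ LightBound (T ω) t D} + (μ.real (bad 1) +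
          ∑ m ∈ Finset.range (16 * N), μ.real (bad (levelExponent D m))) := by
        refine (measureReal_mono subset_union (measure_ne_top _ _)).trans
          ((measureReal_union_le _ _).trans (add_le_add le_rfl ?_))
        exact (measureReal_union_le _ _).trans
          (add_le_add le_rfl (measureReal_biUnion_finset_le _ _))
    _ ≤ 1 / N + (1 / N + ∑ _ ∈ Finset.range (16 * N), ((N : ℝ) ^ 2)⁻¹) :=
        add_le_add (light_le.trans exp_le) (add_le_add ((discrepancy_le 1).trans inv_sq_le)
          (Finset.sum_le_sum fun m _ => discrepancy_le _))
    _ = 18 / N := by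
        rw [Finset.sum_const, Finset.card_range, nsmul_eq_mul]
        push_cast
        field_simp
        ring

end RandomRegularity

section RandomLabels

/-- The strictly upper triangular part of the symmetric matrix whose entries are the values of `g`
at the unordered pairs. -/
def upper {V : Type*} [LT V] [DecidableLT V] (g : Sym2 V → ℝ) (i j : V) : ℝ :=
  if i < j then g s(i, j) else 0

lemma sum_mul_upper {V : Type*} [Fintype V] [LinearOrder V] (c : V → V → ℝ) (g : Sym2 V → ℝ) :
    ∑ i, ∑ j, c i j * upper g i j = ∑ e with ¬ e.IsDiag, c e.inf e.sup * g e := by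
  rw [← Finset.sym2_univ, Finset.sum_sym2_filter_not_isDiag, ← Finset.sum_product']
  simp only [upper, mul_ite, mul_zero, ← Finset.sum_filter]
  refine Finset.sum_congr (Finset.ext fun q => ?_) fun q hq => ?_
  · simpa using ne_of_lt
  · have lt := (Finset.mem_filter.1 hq).2
    rw [Sym2.inf_mk, Sym2.sup_mk, inf_eq_left.2 lt.le, sup_eq_right.2 lt.le]

instance instDiscreteMeasurableSpaceSimpleGraph {V : Type*} [Finite V] :
    DiscreteMeasurableSpace (SimpleGraph V) := by
  have : MeasurableSingletonClass (SimpleGraph V) := ⟨fun G => by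
    have singleton_eq : ({G} : Set (SimpleGraph V)) = SimpleGraph.Adj ⁻¹' {G.Adj} :=
      Set.ext fun H => SimpleGraph.ext_iff
    rw [singleton_eq]
    exact SimpleGraph.measurable_adj (measurableSet_singleton _)⟩
  infer_instance

variable {V : Type*}

/-- The mod 2 sum of the labels of the two endpoints of a pair. -/
def xorLabel (x : V → ZMod 2) : Sym2 V → ZMod 2 :=
  Sym2.lift ⟨fun i j => x i + x j, fun _ _ => add_comm _ _⟩

lemma xorLabel_mk (x : V → ZMod 2) (i j : V) : xorLabel x s(i, j) = x i + x j := rfl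

open Classical in
/-- The indicator of the event that a pair is an edge with observed label `1`. -/
def edgeLabel (x : V → ZMod 2) (G : SimpleGraph V) (z : Sym2 V → ZMod 2) (e : Sym2 V) : ℝ :=
  if e ∈ G.edgeSet then (if xorLabel x e + z e = 1 then 1 else 0) else 0

lemma edgeLabel_nonneg (x : V → ZMod 2) (G : SimpleGraph V) (z : Sym2 V → ZMod 2) (e : Sym2 V) :
    0 ≤ edgeLabel x G z e := by
  unfold edgeLabel
  positivity

lemma edgeLabel_of_isDiag (x : V → ZMod 2) (G : SimpleGraph V) (z : Sym2 V → ZMod 2) {e : Sym2 V}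
    (he : e.IsDiag) : edgeLabel x G z e = 0 :=
  if_neg fun h => G.not_isDiag_of_mem_edgeSet h he

lemma observation_mk [Fintype V] {G : SimpleGraph V} (x : V → ZMod 2) (z : Sym2 V → ZMod 2)
    {i j : V} (h : G.Adj i j) : observation G x z ⟨s(i, j), h⟩ = x i + x j + z s(i, j) := by
  classical
  have incidence (v : V) : (G.incMatrix (ZMod 2)).transpose s(i, j) v * x v =
      (if v = i then x v else 0) + (if v = j then x v else 0) := by
    have hne := h.ne
    rw [Matrix.transpose_apply, SimpleGraph.incMatrix_apply']
    rcases eq_or_ne v i with rfl | hvi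
    · simp [SimpleGraph.incidenceSet, h, hne]
    · rcases eq_or_ne v j with rfl | hvj
      · simp [SimpleGraph.incidenceSet, h, hne.symm]
      · simp [SimpleGraph.incidenceSet, hvi, hvj]
  rw [observation, Matrix.mulVec, dotProduct]
  congr 1
  rw [Finset.sum_congr rfl fun v _ => incidence v, Finset.sum_add_distrib]
  simp

lemma labelMatrix_observation [Fintype V] (x : V → ZMod 2) (G : SimpleGraph V)
    (z : Sym2 V → ZMod 2) (i j : V) :
    labelMatrix G (observation G x z) i j = edgeLabel x G z s(i, j) := by
  by_cases h : G.Adj i j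
  · rw [labelMatrix, Matrix.of_apply, dif_pos h, observation_mk, edgeLabel,
      if_pos (G.mem_edgeSet.2 h), xorLabel_mk]
  · rw [labelMatrix, Matrix.of_apply, dif_neg h, edgeLabel, if_neg (G.mem_edgeSet.not.2 h)]

/-- The probability that the sum of a fixed label `a` and an independent Bernoulli(`ε`) label
is `1`. -/
def labelRate (ε : ℝ) (a : ZMod 2) : ℝ := if a = 0 then ε else 1 - ε

lemma labelRate_mem_Icc (ε : unitInterval) (a : ZMod 2) : labelRate ε a ∈ Set.Icc 0 1 := by
  unfold labelRate
  split_ifs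
  · exact ε.2
  · exact Set.Icc.mem_iff_one_sub_mem.1 ε.2

lemma zmod_two_eq_zero_or_one (a : ZMod 2) : a = 0 ∨ a = 1 := by
  revert a
  decide

lemma integral_exp_mul_noisy_label (ε : unitInterval) (a : ZMod 2) (c : ℝ) :
    ∫ b, Real.exp (c * if a + b = 1 then 1 else 0) ∂(bernoulliMeasure (1 : ZMod 2) 0 ε) =
      1 + labelRate ε a * (Real.exp c - 1) := by
  rw [integral_bernoulliMeasure]
  rcases zmod_two_eq_zero_or_one a with rfl | rfl <;>
    simp [labelRate, show (1 : ZMod 2) + 1 = 0 from rfl] <;> ring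

variable [Fintype V]

open Classical in
lemma integral_exp_sum_mul_edgeLabel (ε : unitInterval) (x : V → ZMod 2) (G : SimpleGraph V)
    (C : Sym2 V → ℝ) :
    ∫ z, Real.exp (∑ e, C e * edgeLabel x G z e)
        ∂(Measure.pi fun _ : Sym2 V => bernoulliMeasure (1 : ZMod 2) 0 ε) =
      ∏ e, if e ∈ G.edgeSet then 1 + labelRate ε (xorLabel x e) * (Real.exp (C e) - 1) else 1 := by
  simp only [Real.exp_sum, edgeLabel]
  rw [integral_fintype_prod_eq_prod fun e b =>
    Real.exp (C e * if e ∈ G.edgeSet then (if xorLabel x e + b = 1 then 1 else 0) else 0)]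
  refine Finset.prod_congr rfl fun e _ => ?_
  split_ifs
  · exact integral_exp_mul_noisy_label _ _ _
  · simp

open Classical in
lemma integral_binomialRandom_prod (p : unitInterval) (g : Sym2 V → Prop → ℝ) :
    ∫ G, ∏ e, g e (e ∈ G.edgeSet) ∂(SimpleGraph.binomialRandom V p) =
      ∏ e : Sym2 V, if e.IsDiag then g e False else p * g e True + (1 - p) * g e False := by
  rw [SimpleGraph.binomialRandom_eq_map, integral_map
    SimpleGraph.measurable_fromEdgeSet.aemeasurable
    (Measurable.of_discrete (f := fun G : SimpleGraph V =>
      ∏ e, g e (e ∈ G.edgeSet))).aestronglyMeasurable,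
    setBernoulli_eq_map, Measure.infinitePi_eq_pi,
    show (fun q : Sym2 V → Prop => {i | q i}) = MeasurableEquiv.setOfPred from rfl,
    integral_map_equiv]
  have mem_edgeSet (q : Sym2 V → Prop) (e : Sym2 V) :
      (e ∈ (SimpleGraph.fromEdgeSet (MeasurableEquiv.setOfPred q)).edgeSet) =
        (q e ∧ ¬ e.IsDiag) := by
    rw [SimpleGraph.edgeSet_fromEdgeSet]
    rfl
  simp only [mem_edgeSet]
  rw [integral_fintype_prod_eq_prod fun e q => g e (q ∧ ¬ e.IsDiag)]
  refine Finset.prod_congr rfl fun e _ => ?_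
  rw [integral_add_measure Integrable.of_finite Integrable.of_finite,
    integral_smul_nnreal_measure, integral_smul_nnreal_measure, integral_dirac, integral_dirac]
  split_ifs with diag
  · simp [diag, NNReal.smul_def]
    ring
  · simp [diag, NNReal.smul_def]

/-- The random graph and marks of `law` on an arbitrary finite vertex set. -/
def markedGraphLaw (V : Type*) [Fintype V] (p ε : unitInterval) :
    Measure (SimpleGraph V × (Sym2 V → ZMod 2)) :=
  (SimpleGraph.binomialRandom V p).prod
    (Measure.pi fun _ : Sym2 V => bernoulliMeasure (1 : ZMod 2) 0 ε)

instance (p ε : unitInterval) : IsProbabilityMeasure (markedGraphLaw V p ε) := by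
  unfold markedGraphLaw
  infer_instance

open Classical in
lemma integral_exp_sum_mul_edgeLabel_markedGraphLaw (p ε : unitInterval) (x : V → ZMod 2)
    (C : Sym2 V → ℝ) :
    ∫ ω, Real.exp (∑ e, C e * edgeLabel x ω.1 ω.2 e) ∂(markedGraphLaw V p ε) =
      ∏ e : Sym2 V, if e.IsDiag then 1 else
        1 + p * labelRate ε (xorLabel x e) * (Real.exp (C e) - 1) := by
  rw [markedGraphLaw, integral_prod _ Integrable.of_finite]
  simp only [integral_exp_sum_mul_edgeLabel]
  refine Eq.trans (by congr!) ((integral_binomialRandom_prod p fun e Q =>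
    if Q then 1 + labelRate ε (xorLabel x e) * (Real.exp (C e) - 1) else 1).trans ?_)
  refine Finset.prod_congr rfl fun e _ => ?_
  simp only [if_true, if_false]
  split_ifs <;> ring

theorem expMomentBound_edgeLabel [LinearOrder V] (p ε : unitInterval) (x : V → ZMod 2) :
    ExpMomentBound (markedGraphLaw V p ε) (fun ω => upper (edgeLabel x ω.1 ω.2))
      (upper fun e => p * labelRate ε (xorLabel x e)) := by
  classical
  intro c
  refine ⟨Integrable.of_finite, ?_⟩
  set C : Sym2 V → ℝ := fun e => c e.inf e.sup
  set q : Sym2 V → ℝ := fun e => p * labelRate ε (xorLabel x e)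
  have mean_eq : ∑ i, ∑ j, upper q i j * (Real.exp (c i j) - 1) =
      ∑ e : Sym2 V, if e.IsDiag then 0 else q e * (Real.exp (C e) - 1) := by
    simp only [mul_comm (upper _ _ _)]
    rw [sum_mul_upper fun i j => Real.exp (c i j) - 1, Finset.sum_filter]
    simp only [ite_not, C, mul_comm (q _)]
  have sum_eq (ω : SimpleGraph V × (Sym2 V → ZMod 2)) :
      ∑ i, ∑ j, c i j * upper (edgeLabel x ω.1 ω.2) i j = ∑ e, C e * edgeLabel x ω.1 ω.2 e := by
    rw [sum_mul_upper]
    exact Finset.sum_filter_of_ne fun e _ he diag =>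
      he (by rw [edgeLabel_of_isDiag x _ _ diag, mul_zero])
  have q_mem (e : Sym2 V) : q e ∈ Set.Icc 0 1 := unitInterval.mul_mem p.2 (labelRate_mem_Icc ε _)
  simp only [sum_eq]
  rw [integral_exp_sum_mul_edgeLabel_markedGraphLaw, mean_eq, Real.exp_sum]
  refine Finset.prod_le_prod (fun e _ => ?_) fun e _ => ?_ <;> split_ifs
  · exact zero_le_one
  · nlinarith [(q_mem e).1, (q_mem e).2, mul_nonneg (q_mem e).1 (Real.exp_pos (C e)).le]
  · rw [Real.exp_zero]
  · rw [add_comm]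
    exact Real.add_one_le_exp _

end RandomLabels

section SpectralPerturbation

variable {E : Type*} [NormedAddCommGroup E] [InnerProductSpace ℝ E]

lemma opNorm_le_of_abs_inner_le {L : E →L[ℝ] E} (hL : (L : E →ₗ[ℝ] E).IsSymmetric) {k : ℝ}
    (h : ∀ u, ‖u‖ ≤ 1 → |inner ℝ (L u) u| ≤ k) : ‖L‖ ≤ k := by
  rw [L.norm_eq_iSup_rayleighQuotient hL]
  refine ciSup_le fun u => ?_
  rcases eq_or_ne u 0 with rfl | hu
  · rw [L.rayleighQuotient_apply_zero, abs_zero]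
    exact (abs_nonneg _).trans (h 0 (norm_zero.trans_le zero_le_one))
  · have unit : ‖‖u‖⁻¹ • u‖ = 1 := norm_smul_inv_norm (𝕜 := ℝ) hu
    rw [← L.rayleigh_smul u (inv_ne_zero (norm_ne_zero_iff.2 hu)),
      ContinuousLinearMap.rayleighQuotient, unit, one_pow, div_one,
      ContinuousLinearMap.reApplyInnerSelf_apply, RCLike.re_to_real]
    exact h _ unit.le

lemma norm_sub_smul_le_of_inner_eq_zero {u₁ u₂ v : E} (h₁₂ : inner ℝ u₁ u₂ = (0 : ℝ))
    (hv : inner ℝ u₁ v = (0 : ℝ)) (a c : ℝ) : ‖v - c • u₂‖ ≤ ‖v - (a • u₁ + c • u₂)‖ := by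
  have orthogonal : inner ℝ (v - c • u₂) (a • u₁) = (0 : ℝ) := by
    rw [inner_sub_left, real_inner_smul_left, real_inner_smul_right, real_inner_smul_right,
      real_inner_comm, hv, real_inner_comm, h₁₂]
    ring
  rw [add_comm, ← sub_sub]
  refine abs_le_of_sq_le_sq' ?_ (norm_nonneg _) |>.2
  rw [sq, sq, norm_sub_sq_eq_norm_sq_add_norm_sq_real orthogonal]
  exact le_add_of_nonneg_right (mul_self_nonneg _)

lemma mul_norm_le_norm_apply_of_mem_span_pair {g : E →ₗ[ℝ] E} {u₁ u₂ w : E} {a₁ a₂ l : ℝ}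
    (h₁₂ : inner ℝ u₁ u₂ = (0 : ℝ)) (hg₁ : g u₁ = a₁ • u₁) (hg₂ : g u₂ = a₂ • u₂)
    (hl : 0 ≤ l) (ha₁ : l ≤ |a₁|) (ha₂ : l ≤ |a₂|) (hw : w ∈ Submodule.span ℝ {u₁, u₂}) :
    l * ‖w‖ ≤ ‖g w‖ := by
  obtain ⟨s, t, rfl⟩ := Submodule.mem_span_pair.1 hw
  have pythagoras (c d : ℝ) : ‖c • u₁ + d • u₂‖ ^ 2 = c ^ 2 * ‖u₁‖ ^ 2 + d ^ 2 * ‖u₂‖ ^ 2 := by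
    rw [norm_add_sq_real, real_inner_smul_left, real_inner_smul_right, h₁₂, norm_smul, norm_smul,
      mul_pow, mul_pow, Real.norm_eq_abs, Real.norm_eq_abs, sq_abs, sq_abs]
    ring
  have sq_le {a : ℝ} (ha : l ≤ |a|) : l ^ 2 ≤ a ^ 2 := sq_le_sq.2 ((abs_of_nonneg hl).trans_le ha)
  refine abs_le_of_sq_le_sq' ?_ (norm_nonneg _) |>.2
  calc (l * ‖s • u₁ + t • u₂‖) ^ 2
      = l ^ 2 * (s ^ 2 * ‖u₁‖ ^ 2) + l ^ 2 * (t ^ 2 * ‖u₂‖ ^ 2) := by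
        rw [mul_pow, pythagoras, mul_add]
    _ ≤ a₁ ^ 2 * (s ^ 2 * ‖u₁‖ ^ 2) + a₂ ^ 2 * (t ^ 2 * ‖u₂‖ ^ 2) := by
        gcongr ?_ * _ + ?_ * _
        exacts [sq_le ha₁, sq_le ha₂]
    _ = ‖(s * a₁) • u₁ + (t * a₂) • u₂‖ ^ 2 := by rw [pythagoras]; ring
    _ = ‖g (s • u₁ + t • u₂)‖ ^ 2 := by
        rw [map_add, map_smul, map_smul, hg₁, hg₂, smul_smul, smul_smul]

lemma finrank_span_pair {u₁ u₂ : E} (hu₁ : u₁ ≠ 0) (hu₂ : u₂ ≠ 0)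
    (h₁₂ : inner ℝ u₁ u₂ = (0 : ℝ)) : Module.finrank ℝ (Submodule.span ℝ {u₁, u₂}) = 2 := by
  have independent : LinearIndependent ℝ ![u₁, u₂] := by
    refine linearIndependent_of_ne_zero_of_inner_eq_zero (𝕜 := ℝ) ?_ ?_
    · simp [Fin.forall_fin_two, hu₁, hu₂]
    · simp [Pairwise, Fin.forall_fin_two, h₁₂, real_inner_comm u₁ u₂]
  rw [← Matrix.range_cons_cons_empty _ _ ![], finrank_span_eq_card independent, Fintype.card_fin]

lemma exists_mem_ne_zero_forall_inner_eq_zero {κ : Type*} [Fintype κ] (u : κ → E)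
    {W : Submodule ℝ E} (hW : Fintype.card κ < Module.finrank ℝ W) :
    ∃ w ∈ W, w ≠ 0 ∧ ∀ k, inner ℝ (u k) w = (0 : ℝ) := by
  have : FiniteDimensional ℝ W := Module.finite_of_finrank_pos (Nat.zero_lt_of_lt hW)
  let coordinates : W →ₗ[ℝ] κ → ℝ := LinearMap.pi fun k => (innerₛₗ ℝ (u k)).comp W.subtype
  obtain ⟨w, mem, ne⟩ := Submodule.exists_mem_ne_zero_of_ne_bot
    (LinearMap.ker_ne_bot_of_finrank_lt (f := coordinates) (by
      rwa [Module.finrank_fintype_fun_eq_card]))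
  exact ⟨w, w.2, fun h => ne (Subtype.ext h), congrFun (LinearMap.mem_ker.1 mem)⟩

section Eigenbasis

variable {ι : Type*} [Fintype ι] {f : E →ₗ[ℝ] E} (b : OrthonormalBasis ι ℝ E) {μ : ι → ℝ}

lemma norm_apply_sq_eq_sum (hb : ∀ i, f (b i) = μ i • b i) (v : E) :
    ‖f v‖ ^ 2 = ∑ i, μ i ^ 2 * inner ℝ (b i) v ^ 2 := by
  have apply_eq : f v = ∑ i, (inner ℝ (b i) v * μ i) • b i := by
    conv_lhs => rw [← b.sum_repr' v]
    rw [map_sum]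
    exact Finset.sum_congr rfl fun i _ => by rw [map_smul, hb, smul_smul]
  rw [← b.sum_sq_norm_inner_right, apply_eq]
  refine Finset.sum_congr rfl fun i _ => ?_
  rw [b.orthonormal.inner_right_fintype, Real.norm_eq_abs, sq_abs, mul_pow, mul_comm]

lemma norm_sq_eq_sum_inner_sq (v : E) : ‖v‖ ^ 2 = ∑ i, inner ℝ (b i) v ^ 2 := by
  rw [← b.sum_sq_norm_inner_right]
  exact Finset.sum_congr rfl fun i _ => sq_abs _

lemma norm_apply_le_of_inner_eq_zero (hb : ∀ i, f (b i) = μ i • b i) {v : E} {k : ℝ} (hk : 0 ≤ k)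
    (h : ∀ i, inner ℝ (b i) v = (0 : ℝ) ∨ |μ i| ≤ k) : ‖f v‖ ≤ k * ‖v‖ := by
  refine abs_le_of_sq_le_sq' ?_ (by positivity) |>.2
  rw [norm_apply_sq_eq_sum b hb, mul_pow, norm_sq_eq_sum_inner_sq b, Finset.mul_sum]
  refine Finset.sum_le_sum fun i _ => ?_
  rcases h i with inner_zero | le
  · rw [inner_zero, zero_pow two_ne_zero, mul_zero, mul_zero]
  · exact mul_le_mul_of_nonneg_right (sq_le_sq.2 (le.trans (le_abs_self k))) (sq_nonneg _)

lemma mul_norm_le_norm_apply_of_inner_eq_zero (hb : ∀ i, f (b i) = μ i • b i) {v : E} {l : ℝ}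
    (hl : 0 ≤ l) (h : ∀ i, inner ℝ (b i) v = (0 : ℝ) ∨ l ≤ |μ i|) : l * ‖v‖ ≤ ‖f v‖ := by
  refine abs_le_of_sq_le_sq' ?_ (norm_nonneg _) |>.2
  rw [norm_apply_sq_eq_sum b hb, mul_pow, norm_sq_eq_sum_inner_sq b, Finset.mul_sum]
  refine Finset.sum_le_sum fun i _ => ?_
  rcases h i with inner_zero | le
  · rw [inner_zero, zero_pow two_ne_zero, mul_zero, mul_zero]
  · exact mul_le_mul_of_nonneg_right (sq_le_sq.2 ((abs_of_nonneg hl).trans_le le)) (sq_nonneg _)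

/- Weyl's argument: `W` contains a nonzero vector orthogonal to the members of `S` other than `i`,
which `f` stretches by at most `|μ i|`. -/
lemma le_abs_eigenvalue_of_mem (hb : ∀ i, f (b i) = μ i • b i) {W : Submodule ℝ E} {l : ℝ}
    (hW : ∀ w ∈ W, l * ‖w‖ ≤ ‖f w‖) {S : Finset ι} (hS : S.card ≤ Module.finrank ℝ W)
    (hdom : ∀ i ∈ S, ∀ j ∉ S, |μ j| ≤ |μ i|) {i : ι} (hi : i ∈ S) : l ≤ |μ i| := by
  classical
  obtain ⟨w, hwW, hw, orthogonal⟩ := exists_mem_ne_zero_forall_inner_eq_zero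
    (fun j : S.erase i => b j)
    ((Fintype.card_coe _).trans_lt ((Finset.card_erase_lt_of_mem hi).trans_le hS))
  have norm_le : ‖f w‖ ≤ |μ i| * ‖w‖ := by
    refine norm_apply_le_of_inner_eq_zero b hb (abs_nonneg _) fun j => ?_
    by_cases hj : j ∈ S
    · rcases eq_or_ne j i with rfl | hji
      · exact .inr le_rfl
      · exact .inl (orthogonal ⟨j, Finset.mem_erase.2 ⟨hji, hj⟩⟩)
    · exact .inr (hdom i hi j hj)
  exact le_of_mul_le_mul_right ((hW w hwW).trans norm_le) (norm_pos_iff.2 hw)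

lemma exists_preimage_of_mem_span (hb : ∀ i, f (b i) = μ i • b i) {S : Set ι} {l : ℝ} (hl : 0 < l)
    (hμ : ∀ i ∈ S, l ≤ |μ i|) {v : E} (hv : v ∈ Submodule.span ℝ (b '' S)) :
    ∃ u, f u = v ∧ l * ‖u‖ ≤ ‖v‖ := by
  have span_le : Submodule.span ℝ (b '' S) ≤ (Submodule.span ℝ (b '' S)).map f := by
    refine Submodule.span_le.2 (Set.image_subset_iff.2 fun i hi => ?_)
    refine ⟨(μ i)⁻¹ • b i, Submodule.smul_mem _ _ (Submodule.subset_span ⟨i, hi, rfl⟩), ?_⟩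
    rw [map_smul, hb, inv_smul_smul₀ (abs_pos.1 (hl.trans_le (hμ i hi)))]
  obtain ⟨u, hu, rfl⟩ := span_le hv
  refine ⟨u, rfl, mul_norm_le_norm_apply_of_inner_eq_zero b hb hl.le fun i => ?_⟩
  rw [← b.coe_toBasis] at hu
  by_cases hi : i ∈ S
  · exact .inr (hμ i hi)
  · left
    rw [← b.repr_apply_apply, ← b.coe_toBasis_repr_apply]
    exact Finsupp.notMem_support_iff.1 fun h => hi (b.toBasis.mem_span_image.1 hu h)

/- A vector of the dominant eigenspace is `f u` with `u` short, hence close to `g u`. -/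
lemma exists_norm_sub_apply_le {g : E →ₗ[ℝ] E} {κ l : ℝ} (hb : ∀ i, f (b i) = μ i • b i)
    (hfg : ∀ u, ‖f u - g u‖ ≤ κ * ‖u‖) (hκ : 0 ≤ κ) (hl : κ < l) {W : Submodule ℝ E}
    (hW : ∀ w ∈ W, l * ‖w‖ ≤ ‖g w‖) {S : Finset ι} (hS : S.card ≤ Module.finrank ℝ W)
    (hdom : ∀ i ∈ S, ∀ j ∉ S, |μ j| ≤ |μ i|) {v : E}
    (hv : v ∈ Submodule.span ℝ (b '' (S : Set ι))) :
    ∃ u, ‖v - g u‖ ≤ κ / (l - κ) * ‖v‖ := by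
  have gap : 0 < l - κ := sub_pos.2 hl
  have expands (w : E) (hw : w ∈ W) : (l - κ) * ‖w‖ ≤ ‖f w‖ := by
    linarith [hW w hw, hfg w, norm_le_norm_add_norm_sub (f w) (g w)]
  obtain ⟨u, rfl, short⟩ := exists_preimage_of_mem_span b hb gap
    (fun i hi => le_abs_eigenvalue_of_mem b hb expands hS hdom hi) hv
  refine ⟨u, (hfg u).trans ?_⟩
  rw [div_mul_eq_mul_div, mul_div_assoc]
  exact mul_le_mul_of_nonneg_left ((le_div_iff₀' gap).2 short) hκ

theorem exists_norm_sub_smul_le {g : E →ₗ[ℝ] E} {κ l : ℝ} (hb : ∀ i, f (b i) = μ i • b i)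
    (hfg : ∀ u, ‖f u - g u‖ ≤ κ * ‖u‖) (hκ : 0 ≤ κ) (hl : κ < l) {u₁ u₂ : E} {a₁ a₂ : ℝ}
    (hu₁ : u₁ ≠ 0) (hu₂ : u₂ ≠ 0) (h₁₂ : inner ℝ u₁ u₂ = (0 : ℝ))
    (hg : ∀ u, g u ∈ Submodule.span ℝ {u₁, u₂}) (hg₁ : g u₁ = a₁ • u₁) (hg₂ : g u₂ = a₂ • u₂)
    (ha₁ : l ≤ |a₁|) (ha₂ : l ≤ |a₂|) {S : Finset ι} (hS : S.card = 2)
    (hdom : ∀ i ∈ S, ∀ j ∉ S, |μ j| ≤ |μ i|) {v : E}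
    (hv : v ∈ Submodule.span ℝ (b '' (S : Set ι))) (hv₁ : inner ℝ u₁ v = (0 : ℝ)) :
    ∃ c : ℝ, ‖v - c • u₂‖ ≤ κ / (l - κ) * ‖v‖ := by
  obtain ⟨u, close⟩ := exists_norm_sub_apply_le b hb hfg hκ hl
    (fun w => mul_norm_le_norm_apply_of_mem_span_pair h₁₂ hg₁ hg₂ (hκ.trans hl.le) ha₁ ha₂)
    (hS.trans (finrank_span_pair hu₁ hu₂ h₁₂).symm).le hdom hv
  obtain ⟨a, c, image_eq⟩ := Submodule.mem_span_pair.1 (hg u)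
  refine ⟨c, (norm_sub_smul_le_of_inner_eq_zero h₁₂ hv₁ a c).trans ?_⟩
  rwa [image_eq]

end Eigenbasis

end SpectralPerturbation

section IntegerVectors

variable {V : Type*} [Fintype V]

lemma exists_int_abs_le_abs_sub_le_one (a : ℝ) : ∃ z : ℤ, |(z : ℝ)| ≤ |a| ∧ |a - z| ≤ 1 := by
  wlog ha : 0 ≤ a generalizing a
  · obtain ⟨z, abs_le, near⟩ := this (-a) (neg_nonneg.2 (not_le.1 ha).le)
    refine ⟨-z, ?_, ?_⟩
    · rwa [Int.cast_neg, abs_neg, ← abs_neg a]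
    · rwa [Int.cast_neg, ← abs_neg, neg_sub', neg_neg]
  · refine ⟨⌊a⌋, abs_le_abs_of_nonneg (Int.cast_nonneg (Int.floor_nonneg.2 ha)) (Int.floor_le a),
      ?_⟩
    rw [Int.self_sub_floor, abs_of_nonneg (Int.fract_nonneg a)]
    exact (Int.fract_lt_one a).le

/-- The vector with the integer coordinates `z`. -/
def intVector (z : V → ℤ) : EuclideanSpace ℝ V := WithLp.toLp 2 fun i => (z i : ℝ)

lemma norm_intVector_sq (z : V → ℤ) : ‖intVector z‖ ^ 2 = ∑ i, (z i : ℝ) ^ 2 :=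
  EuclideanSpace.real_norm_sq_eq _

lemma exists_intVector_near (x : EuclideanSpace ℝ V) :
    ∃ z : V → ℤ, ‖intVector z‖ ≤ ‖x‖ ∧ ‖x - intVector z‖ ≤ √(Fintype.card V) := by
  choose z abs_le near using fun i => exists_int_abs_le_abs_sub_le_one (x i)
  refine ⟨z, abs_le_of_sq_le_sq' ?_ (norm_nonneg _) |>.2, Real.le_sqrt_of_sq_le ?_⟩
  · rw [EuclideanSpace.real_norm_sq_eq, EuclideanSpace.real_norm_sq_eq]
    exact Finset.sum_le_sum fun i _ => sq_le_sq.2 (abs_le i)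
  · rw [EuclideanSpace.real_norm_sq_eq, ← nsmul_one, ← Finset.card_univ]
    exact Finset.sum_le_card_nsmul _ _ _ fun i _ => (sq_le_one_iff_abs_le_one _).2 (near i)

lemma abs_inner_apply_sub_inner_apply_le {E : Type*} [NormedAddCommGroup E]
    [InnerProductSpace ℝ E] (L : E →L[ℝ] E) (x y : E) :
    |inner ℝ (L x) x - inner ℝ (L y) y| ≤ ‖L‖ * ‖x - y‖ * (‖x‖ + ‖y‖) := by
  have split : inner ℝ (L x) x - inner ℝ (L y) y =
      inner ℝ (L (x - y)) x + inner ℝ (L y) (x - y) := by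
    rw [map_sub, inner_sub_left, inner_sub_right]
    ring
  calc |inner ℝ (L x) x - inner ℝ (L y) y|
      ≤ ‖L (x - y)‖ * ‖x‖ + ‖L y‖ * ‖x - y‖ := by
        rw [split]
        exact (abs_add_le _ _).trans
          (add_le_add (abs_real_inner_le_norm _ _) (abs_real_inner_le_norm _ _))
    _ ≤ ‖L‖ * ‖x - y‖ * ‖x‖ + ‖L‖ * ‖y‖ * ‖x - y‖ := by
        gcongr <;> exact L.le_opNorm _
    _ = ‖L‖ * ‖x - y‖ * (‖x‖ + ‖y‖) := by ring

theorem opNorm_le_of_forall_intVector [Nonempty V]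
    {L : EuclideanSpace ℝ V →L[ℝ] EuclideanSpace ℝ V}
    (hL : (L : EuclideanSpace ℝ V →ₗ[ℝ] EuclideanSpace ℝ V).IsSymmetric) {K : ℝ}
    (h : ∀ z : V → ℤ, ∑ i, (z i : ℝ) ^ 2 ≤ 16 * Fintype.card V →
      |inner ℝ (L (intVector z)) (intVector z)| ≤ K * Fintype.card V) : ‖L‖ ≤ K / 8 := by
  set r : ℝ := √(Fintype.card V)
  have r_sq : r ^ 2 = Fintype.card V := Real.sq_sqrt (Nat.cast_nonneg _)
  have : 0 < r := Real.sqrt_pos.2 (Nat.cast_pos.2 Fintype.card_pos)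
  suffices ‖L‖ ≤ K / 16 + ‖L‖ / 2 by linarith
  refine opNorm_le_of_abs_inner_le hL fun x hx => ?_
  obtain ⟨z, short, near⟩ := exists_intVector_near ((4 * r) • x)
  have scaled_norm_le : ‖(4 * r) • x‖ ≤ 4 * r := by
    rw [norm_smul, Real.norm_of_nonneg (by positivity)]
    exact mul_le_of_le_one_right (by positivity) hx
  have z_sq_le : ∑ i, (z i : ℝ) ^ 2 ≤ 16 * Fintype.card V := by
    calc ∑ i, (z i : ℝ) ^ 2 = ‖intVector z‖ ^ 2 := (norm_intVector_sq z).symm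
      _ ≤ (4 * r) ^ 2 := by
          gcongr
          exact short.trans scaled_norm_le
      _ = 16 * Fintype.card V := by rw [mul_pow, r_sq]; norm_num
  have scale : inner ℝ (L ((4 * r) • x)) ((4 * r) • x) = 16 * r ^ 2 * inner ℝ (L x) x := by
    rw [map_smul, real_inner_smul_left, real_inner_smul_right]
    ring
  have rounding : |inner ℝ (L ((4 * r) • x)) ((4 * r) • x) -
      inner ℝ (L (intVector z)) (intVector z)| ≤ 8 * r ^ 2 * ‖L‖ := by
    refine (abs_inner_apply_sub_inner_apply_le L _ _).trans ?_
    calc ‖L‖ * ‖(4 * r) • x - intVector z‖ * (‖(4 * r) • x‖ + ‖intVector z‖)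
        ≤ ‖L‖ * r * (4 * r + 4 * r) := by
          gcongr
          exact short.trans scaled_norm_le
      _ = 8 * r ^ 2 * ‖L‖ := by ring
  have bound : 16 * r ^ 2 * |inner ℝ (L x) x| ≤ 16 * r ^ 2 * (K / 16 + ‖L‖ / 2) := by
    calc 16 * r ^ 2 * |inner ℝ (L x) x| = |inner ℝ (L ((4 * r) • x)) ((4 * r) • x)| := by
          rw [scale, abs_mul, abs_of_pos (by positivity : 0 < 16 * r ^ 2)]
      _ ≤ 8 * r ^ 2 * ‖L‖ + K * r ^ 2 := by
          rw [r_sq] at rounding ⊢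
          linarith [abs_sub_abs_le_abs_sub (inner ℝ (L ((4 * r) • x)) ((4 * r) • x))
            (inner ℝ (L (intVector z)) (intVector z)), h z z_sq_le]
      _ = 16 * r ^ 2 * (K / 16 + ‖L‖ / 2) := by ring
  exact le_of_mul_le_mul_left bound (by positivity)

lemma inner_toEuclideanCLM_apply_self [DecidableEq V] (A : Matrix V V ℝ)
    (x : EuclideanSpace ℝ V) :
    inner ℝ (Matrix.toEuclideanCLM (𝕜 := ℝ) A x) x = ∑ i, ∑ j, x i * x j * A i j := by
  rw [real_inner_comm, Matrix.inner_toEuclideanCLM, dotProduct]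
  refine Finset.sum_congr rfl fun i _ => ?_
  rw [Matrix.mulVec, dotProduct, Finset.mul_sum]
  exact Finset.sum_congr rfl fun j _ => by ring

lemma norm_toEuclideanCLM_le [DecidableEq V] [Nonempty V] {A : Matrix V V ℝ} (hA : A.IsSymm)
    {K : ℝ} (h : ∀ z : V → ℤ, ∑ i, (z i : ℝ) ^ 2 ≤ 16 * Fintype.card V →
      |∑ i, ∑ j, (z i : ℝ) * z j * A i j| ≤ K * Fintype.card V) :
    ‖Matrix.toEuclideanCLM (𝕜 := ℝ) A‖ ≤ K / 8 := by
  refine opNorm_le_of_forall_intVector ?_ fun z hz => ?_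
  · exact Matrix.isSymmetric_toEuclideanLin_iff.2
      ((Matrix.conjTranspose_eq_transpose_of_trivial A).trans hA)
  · rw [inner_toEuclideanCLM_apply_self]
    exact h z hz

end IntegerVectors

section TopCoordinates

variable {V : Type*} [Fintype V]

lemma exists_top_finset (f : V → ℝ) {k : ℕ} (hk : k ≤ Fintype.card V) :
    ∃ S : Finset V, S.card = k ∧ ∀ i ∈ S, ∀ j ∉ S, f j ≤ f i := by
  classical
  induction k with
  | zero => exact ⟨∅, rfl, fun i hi => absurd hi (Finset.notMem_empty i)⟩
  | succ k ih =>
    obtain ⟨S, card_eq, top⟩ := ih (Nat.le_of_succ_le hk)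
    have complement_nonempty : Sᶜ.Nonempty := by
      rw [← Finset.card_pos, Finset.card_compl, card_eq]
      omega
    obtain ⟨m, hm, max⟩ := Finset.exists_max_image _ f complement_nonempty
    have hmS : m ∉ S := Finset.mem_compl.1 hm
    refine ⟨insert m S, by rw [Finset.card_insert_of_notMem hmS, card_eq], fun i hi j hj => ?_⟩
    rw [Finset.mem_insert, not_or] at hj
    rcases Finset.mem_insert.1 hi with rfl | hi
    · exact max j (Finset.mem_compl.2 hj.2)
    · exact top i hi j hj.2

variable [DecidableEq V]

lemma card_sdiff_mul_sq_le (f : V → ℝ) {c : ℝ} (hc : 0 ≤ c) {A B : Finset V}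
    (card_eq : A.card = B.card) (top : ∀ i ∈ A, ∀ j ∉ A, f j ≤ f i) :
    (B \ A).card * c ^ 2 ≤ ∑ i, (f i - if i ∈ B then c else -c) ^ 2 := by
  have card_mul_sq_le (S : Finset V) (hS : ∀ i ∈ S, c ≤ |f i - if i ∈ B then c else -c|) :
      S.card * c ^ 2 ≤ ∑ i, (f i - if i ∈ B then c else -c) ^ 2 := by
    rw [← nsmul_eq_mul]
    exact (Finset.card_nsmul_le_sum _ _ _ fun i hi =>
      sq_le_sq.2 ((abs_of_nonneg hc).trans_le (hS i hi))).trans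
        (Finset.sum_le_univ_sum_of_nonneg fun _ => sq_nonneg _)
  -- Every misplaced vertex costs `c ^ 2`, on `B \ A` if `f ≤ 0` there and on `A \ B` otherwise.
  by_cases nonpos : ∀ i ∈ B \ A, f i ≤ 0
  · refine card_mul_sq_le _ fun i hi => le_abs.2 (.inr ?_)
    rw [if_pos (Finset.mem_sdiff.1 hi).1]
    linarith [nonpos i hi]
  · push Not at nonpos
    obtain ⟨i, hi, pos⟩ := nonpos
    rw [Finset.card_sdiff_comm card_eq.symm]
    refine card_mul_sq_le _ fun j hj => le_abs.2 (.inl ?_)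
    rw [if_neg (Finset.mem_sdiff.1 hj).2]
    linarith [top j (Finset.mem_sdiff.1 hj).1 i (Finset.mem_sdiff.1 hi).2]

lemma gammaCorrect_compl_of_card_sdiff_le {n : ℕ} {γ : ℝ} (hV : Fintype.card V = 2 * n)
    {A B : Finset V} (hA : A.card = n) (hB : B.card = n) (h : ((B \ A).card : ℝ) ≤ γ * n) :
    GammaCorrect n γ B Bᶜ A Aᶜ := by
  have inter_card : ((B ∩ A).card : ℝ) = n - (B \ A).card := by
    rw [eq_sub_iff_add_eq', ← hB]
    exact_mod_cast Finset.card_sdiff_add_card_inter B A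
  have inter_compl_card : (Bᶜ ∩ Aᶜ).card = (B ∩ A).card := by
    rw [← Finset.compl_union, Finset.card_compl, hV]
    have := Finset.card_union_add_card_inter B A
    omega
  have le_inter_card : (1 - γ) * n ≤ ((B ∩ A).card : ℝ) := by
    rw [inter_card]
    linarith
  exact ⟨le_inter_card, inter_compl_card ▸ le_inter_card⟩

end TopCoordinates

section SignVector

variable {V : Type*}

/-- The `±1` vector of the two communities, equal to `1` on `block x 0`. -/
def signVector (x : V → ZMod 2) : EuclideanSpace ℝ V :=
  WithLp.toLp 2 fun i => if x i = 0 then 1 else -1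

lemma signVector_apply (x : V → ZMod 2) (i : V) :
    signVector x i = if x i = 0 then 1 else -1 := rfl

lemma signVector_add_one (x : V → ZMod 2) : signVector (fun i => x i + 1) = -signVector x := by
  ext i
  rw [PiLp.neg_apply, signVector_apply, signVector_apply]
  rcases zmod_two_eq_zero_or_one (x i) with h | h <;>
    simp [h, show (1 : ZMod 2) + 1 = 0 from rfl]

variable [Fintype V]

lemma mem_block {x : V → ZMod 2} {a : ZMod 2} {i : V} : i ∈ block x a ↔ x i = a := by
  rw [block, Finset.mem_filter_univ]

lemma block_add_one_zero (x : V → ZMod 2) : block (fun i => x i + 1) 0 = block x 1 := by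
  ext i
  rw [mem_block, mem_block]
  exact CharTwo.add_eq_zero

lemma compl_block_one [DecidableEq V] (x : V → ZMod 2) : (block x 1)ᶜ = block x 0 := by
  ext i
  rw [Finset.mem_compl, mem_block, mem_block]
  rcases zmod_two_eq_zero_or_one (x i) with h | h <;> simp [h]

lemma card_block_zero {n : ℕ} (hV : Fintype.card V = 2 * n) {x : V → ZMod 2}
    (hx : (block x 1).card = n) : (block x 0).card = n := by
  classical
  rw [← compl_block_one, Finset.card_compl, hV, hx]
  omega

lemma norm_signVector_sq (x : V → ZMod 2) : ‖signVector x‖ ^ 2 = Fintype.card V := by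
  have sq_eq_one (i : V) : signVector x i ^ 2 = 1 := by
    rw [signVector_apply]
    split_ifs <;> norm_num
  rw [EuclideanSpace.real_norm_sq_eq, Finset.sum_congr rfl fun i _ => sq_eq_one i]
  simp

lemma one_fourth_le_sq_mul_card {x : V → ZMod 2} {v : EuclideanSpace ℝ V} {c : ℝ} (hv : ‖v‖ = 1)
    (near : ‖v - c • signVector x‖ ≤ 1 / 2) : 1 / 4 ≤ c ^ 2 * Fintype.card V := by
  have half_le : 1 / 2 ≤ ‖c • signVector x‖ := by
    linarith [norm_le_norm_add_norm_sub (c • signVector x) v, norm_sub_rev v (c • signVector x)]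
  calc (1 / 4 : ℝ) = (1 / 2) ^ 2 := by norm_num
    _ ≤ ‖c • signVector x‖ ^ 2 := by gcongr
    _ = c ^ 2 * Fintype.card V := by
        rw [norm_smul, mul_pow, norm_signVector_sq, Real.norm_eq_abs, sq_abs]

variable [DecidableEq V] {n : ℕ} {γ δ c : ℝ} {x : V → ZMod 2} {v : EuclideanSpace ℝ V}
  {A : Finset V}

lemma gammaCorrect_of_norm_sub_smul_le (hV : Fintype.card V = 2 * n) (hx : (block x 0).card = n)
    (hc : 0 ≤ c) (hv : ‖v‖ = 1) (near : ‖v - c • signVector x‖ ≤ δ) (hδ : δ ≤ 1 / 2)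
    (hδγ : 4 * δ ≤ γ) (hA : A.card = n) (top : ∀ i ∈ A, ∀ j ∉ A, v j ≤ v i) :
    GammaCorrect n γ (block x 0) (block x 0)ᶜ A Aᶜ := by
  refine gammaCorrect_compl_of_card_sdiff_le hV hA hx ?_
  set k : ℝ := ((block x 0 \ A).card : ℝ)
  have k_mul_sq_le : k * c ^ 2 ≤ δ ^ 2 := by
    calc k * c ^ 2 ≤ ∑ i, (v i - if i ∈ block x 0 then c else -c) ^ 2 :=
          card_sdiff_mul_sq_le _ hc (hA.trans hx.symm) top
      _ = ‖v - c • signVector x‖ ^ 2 := by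
          rw [EuclideanSpace.real_norm_sq_eq]
          simp only [PiLp.sub_apply, PiLp.smul_apply, smul_eq_mul, signVector_apply, mem_block,
            mul_ite, mul_one, mul_neg_one]
      _ ≤ δ ^ 2 := by gcongr
  have card_eq : (Fintype.card V : ℝ) = 2 * n := by exact_mod_cast hV
  have δ_nonneg : 0 ≤ δ := (norm_nonneg _).trans near
  calc k = 4 * (k * (1 / 4)) := by ring
    _ ≤ 4 * (k * (c ^ 2 * Fintype.card V)) := by
        gcongr
        exact one_fourth_le_sq_mul_card hv (near.trans hδ)
    _ = 8 * (k * c ^ 2) * n := by rw [card_eq]; ring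
    _ ≤ 8 * (δ * δ) * n := by
        rw [← sq δ]
        gcongr
    _ ≤ 8 * (δ * (1 / 2)) * n := by gcongr
    _ = 4 * δ * n := by ring
    _ ≤ γ * n := by gcongr

theorem gammaCorrectPartition_of_norm_sub_smul_le (hV : Fintype.card V = 2 * n)
    (hx : (block x 1).card = n) (hv : ‖v‖ = 1) (near : ‖v - c • signVector x‖ ≤ δ)
    (hδ : δ ≤ 1 / 2) (hδγ : 4 * δ ≤ γ) (hA : A.card = n)
    (top : ∀ i ∈ A, ∀ j ∉ A, v j ≤ v i) :
    GammaCorrectPartition n γ (block x 0) (block x 1) A Aᶜ := by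
  rcases le_total 0 c with hc | hc
  · left
    rw [← compl_compl (block x 1), compl_block_one]
    exact gammaCorrect_of_norm_sub_smul_le hV (card_block_zero hV hx) hc hv near hδ hδγ hA top
  · right
    rw [← neg_smul_neg, ← signVector_add_one] at near
    rw [← block_add_one_zero] at hx
    have correct := gammaCorrect_of_norm_sub_smul_le hV hx (neg_nonneg.2 hc) hv near hδ hδγ hA top
    rw [block_add_one_zero, compl_block_one] at correct
    exact correct.symm

end SignVector

section SpectralOutput

lemma exists_isTopEigenspace {V : Type*} [Fintype V] {A : Matrix V V ℝ} (hA : A.IsSymm)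
    (hV : 2 ≤ Fintype.card V) : ∃ U, IsTopEigenspace A U := by
  classical
  have hermitian : A.IsHermitian := (Matrix.conjTranspose_eq_transpose_of_trivial A).trans hA
  obtain ⟨S, hS, top⟩ := exists_top_finset (fun i => |hermitian.eigenvalues i|) hV
  refine ⟨_, hermitian.eigenvectorBasis, hermitian.eigenvalues, S, fun i => ?_, hS, top, rfl⟩
  rw [Matrix.toLpLin_apply, hermitian.mulVec_eigenvectorBasis]
  rfl

lemma IsTopEigenspace.finrank_eq {V : Type*} [Fintype V] {A : Matrix V V ℝ}
    {U : Submodule ℝ (EuclideanSpace ℝ V)} (hU : IsTopEigenspace A U) :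
    Module.finrank ℝ U = 2 := by
  obtain ⟨b, -, S, -, hS, -, rfl⟩ := hU
  have independent : LinearIndependent ℝ fun i : S => b i :=
    b.orthonormal.linearIndependent.comp _ Subtype.val_injective
  rw [Set.image_eq_range, ← hS, ← Fintype.card_coe]
  exact finrank_span_eq_card independent

lemma exists_isSpectralOutput {n : ℕ} (hn : 0 < n) (p : ℝ)
    {Y : Matrix (Fin (2 * n)) (Fin (2 * n)) ℝ} (hY : (trim Y (20 * p * n)).IsSymm) :
    ∃ V₁ V₂, IsSpectralOutput n p Y V₁ V₂ := by
  have card_eq : Fintype.card (Fin (2 * n)) = 2 * n := Fintype.card_fin _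
  obtain ⟨U, hU⟩ := exists_isTopEigenspace hY (by omega)
  set v₁ := U.starProjection (WithLp.toLp 2 fun _ => (1 : ℝ))
  obtain ⟨v, hvU, hv, orthogonal⟩ := exists_mem_ne_zero_forall_inner_eq_zero (fun _ : Unit => v₁)
    (W := U) (by rw [hU.finrank_eq, Fintype.card_unit]; exact one_lt_two)
  set v₂ := ‖v‖⁻¹ • v
  obtain ⟨A, hA, top⟩ := exists_top_finset (fun i => v₂ i) (k := n) (by omega)
  refine ⟨A, Aᶜ, U, v₁, v₂, hU, rfl, U.smul_mem _ hvU, norm_smul_inv_norm (𝕜 := ℝ) hv, ?_, hA,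
    top, rfl⟩
  rw [real_inner_smul_right, orthogonal (), mul_zero]

variable {V : Type*} [Fintype V]

lemma trim_isSymm {Y : Matrix V V ℝ} (hY : Y.IsSymm) (t : ℝ) : (trim Y t).IsSymm := by
  ext i j
  rw [Matrix.transpose_apply, trim, Matrix.of_apply, Matrix.of_apply, hY.apply]
  exact if_congr or_comm rfl rfl

lemma labelMatrix_observation_isSymm (x : V → ZMod 2) (G : SimpleGraph V)
    (z : Sym2 V → ZMod 2) : (labelMatrix G (observation G x z)).IsSymm := by
  ext i j
  rw [Matrix.transpose_apply, labelMatrix_observation, labelMatrix_observation, Sym2.eq_swap]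

end SpectralOutput

section MeanMatrix

variable {V : Type*}

/-- The entrywise expectation of the observed matrix `Y`, except on the diagonal, where `Y`
vanishes and `meanMatrix` is filled in so as to have rank two. -/
def meanMatrix (p ε : ℝ) (x : V → ZMod 2) : Matrix V V ℝ :=
  Matrix.of fun i j => p * labelRate ε (xorLabel x s(i, j))

lemma meanMatrix_isSymm (p ε : ℝ) (x : V → ZMod 2) : (meanMatrix p ε x).IsSymm := by
  ext i j
  rw [Matrix.transpose_apply, meanMatrix, Matrix.of_apply, Matrix.of_apply, Sym2.eq_swap]

lemma labelRate_xorLabel (ε : ℝ) (x : V → ZMod 2) (i j : V) :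
    labelRate ε (xorLabel x s(i, j)) =
      1 / 2 - (1 - 2 * ε) / 2 * (signVector x i * signVector x j) := by
  rw [signVector_apply, signVector_apply, xorLabel_mk]
  rcases zmod_two_eq_zero_or_one (x i) with hi | hi <;>
    rcases zmod_two_eq_zero_or_one (x j) with hj | hj <;>
    simp [hi, hj, labelRate, show (1 : ZMod 2) + 1 = 0 from rfl] <;> ring

/-- The all-ones vector of the algorithm. -/
def onesVector (V : Type*) : EuclideanSpace ℝ V := WithLp.toLp 2 fun _ => (1 : ℝ)

variable [Fintype V]

lemma norm_onesVector_sq : ‖onesVector V‖ ^ 2 = Fintype.card V := by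
  rw [EuclideanSpace.real_norm_sq_eq]
  simp [onesVector]

lemma inner_onesVector_signVector {x : V → ZMod 2} (hx : (block x 0).card = (block x 1).card) :
    inner ℝ (onesVector V) (signVector x) = 0 := by
  have apply_eq (i : V) :
      signVector x i = (if x i = 0 then 1 else 0) - if x i = 1 then 1 else 0 := by
    rw [signVector_apply]
    rcases zmod_two_eq_zero_or_one (x i) with h | h <;> simp [h]
  rw [block, block] at hx
  simp only [PiLp.inner_apply, onesVector, RCLike.inner_apply, conj_trivial, mul_one, apply_eq,
    Finset.sum_sub_distrib, Finset.sum_boole, hx, sub_self]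

lemma toEuclideanLin_meanMatrix_apply [DecidableEq V] (p ε : ℝ) (x : V → ZMod 2)
    (u : EuclideanSpace ℝ V) :
    Matrix.toEuclideanLin (meanMatrix p ε x) u =
      (p / 2 * inner ℝ (onesVector V) u) • onesVector V +
      (-((1 - 2 * ε) * (p / 2)) * inner ℝ (signVector x) u) • signVector x := by
  ext i
  simp only [Matrix.toLpLin_apply, PiLp.add_apply, PiLp.smul_apply, PiLp.inner_apply,
    Matrix.mulVec, dotProduct, meanMatrix, Matrix.of_apply, labelRate_xorLabel, onesVector,
    RCLike.inner_apply, conj_trivial, smul_eq_mul, mul_one, Finset.mul_sum, Finset.sum_mul,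
    ← Finset.sum_add_distrib]
  exact Finset.sum_congr rfl fun j _ => by ring

lemma toEuclideanLin_meanMatrix_onesVector [DecidableEq V] (p ε : ℝ) {x : V → ZMod 2}
    (hx : (block x 0).card = (block x 1).card) :
    Matrix.toEuclideanLin (meanMatrix p ε x) (onesVector V) =
      (p / 2 * Fintype.card V) • onesVector V := by
  rw [toEuclideanLin_meanMatrix_apply, real_inner_comm (onesVector V) (signVector x),
    inner_onesVector_signVector hx, real_inner_self_eq_norm_sq, norm_onesVector_sq,
    mul_zero, zero_smul, add_zero]

lemma toEuclideanLin_meanMatrix_signVector [DecidableEq V] (p ε : ℝ) {x : V → ZMod 2}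
    (hx : (block x 0).card = (block x 1).card) :
    Matrix.toEuclideanLin (meanMatrix p ε x) (signVector x) =
      (-((1 - 2 * ε) * (p / 2 * Fintype.card V))) • signVector x := by
  rw [toEuclideanLin_meanMatrix_apply, inner_onesVector_signVector hx,
    real_inner_self_eq_norm_sq, norm_signVector_sq, mul_zero, zero_smul, zero_add,
    neg_mul, mul_assoc]

end MeanMatrix

section MeanApproximation

lemma upper_self {V : Type*} [Preorder V] [DecidableLT V] (g : Sym2 V → ℝ) (i : V) :
    upper g i i = 0 :=
  if_neg (lt_irrefl i)

lemma upper_mem_Icc {V : Type*} [LT V] [DecidableLT V] {g : Sym2 V → ℝ} {q : ℝ}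
    (hg : ∀ e, g e ∈ Set.Icc 0 q) (i j : V) : upper g i j ∈ Set.Icc 0 q := by
  unfold upper
  split_ifs
  · exact hg _
  · exact ⟨le_rfl, (hg s(i, j)).1.trans (hg s(i, j)).2⟩

lemma upper_nonneg {V : Type*} [LT V] [DecidableLT V] {g : Sym2 V → ℝ} (hg : ∀ e, 0 ≤ g e)
    (i j : V) : 0 ≤ upper g i j := by
  unfold upper
  split_ifs
  exacts [hg _, le_rfl]

lemma mul_labelRate_mem_Icc {V : Type*} (p ε : unitInterval) (x : V → ZMod 2) (e : Sym2 V) :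
    (p : ℝ) * labelRate ε (xorLabel x e) ∈ Set.Icc (0 : ℝ) p :=
  have rate_mem := labelRate_mem_Icc ε (xorLabel x e)
  ⟨mul_nonneg p.2.1 rate_mem.1, mul_le_of_le_one_right p.2.1 rate_mem.2⟩

variable {V : Type*} [LinearOrder V]

lemma upper_add_upper_swap (g : Sym2 V → ℝ) {i j : V} (hij : i ≠ j) :
    upper g i j + upper g j i = g s(i, j) := by
  unfold upper
  rcases lt_or_gt_of_ne hij with h | h
  · rw [if_pos h, if_neg h.not_gt, add_zero]
  · rw [if_neg h.not_gt, if_pos h, zero_add, Sym2.eq_swap]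

variable [Fintype V]

lemma labelMatrix_observation_eq_upper_add (x : V → ZMod 2) (G : SimpleGraph V)
    (z : Sym2 V → ZMod 2) (i j : V) :
    labelMatrix G (observation G x z) i j =
      upper (edgeLabel x G z) i j + upper (edgeLabel x G z) j i := by
  rw [labelMatrix_observation]
  rcases eq_or_ne i j with rfl | hij
  · rw [upper_self, add_zero, edgeLabel_of_isDiag x G z (Sym2.mk_isDiag_iff.2 rfl)]
  · exact (upper_add_upper_swap _ hij).symm

theorem norm_toEuclideanCLM_trim_sub_meanMatrix_le {p ε : unitInterval} {x : V → ZMod 2} {D : ℝ}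
    (hD : 1 ≤ D) (hpN : p * (Fintype.card V : ℝ) = 2 * D ^ 2) {G : SimpleGraph V}
    {z : Sym2 V → ZMod 2}
    (regular : IsRegular (upper (edgeLabel x G z))
      (upper fun e => p * labelRate ε (xorLabel x e)) p D) :
    ‖Matrix.toEuclideanCLM (𝕜 := ℝ)
      (trim (labelMatrix G (observation G x z)) (20 * D ^ 2) - meanMatrix p ε x)‖ ≤
        10625 * D := by
  have D_pos : 0 < D := by linarith
  have nonempty : Nonempty V := Fintype.card_pos_iff.1 <| by
    exact_mod_cast (pos_and_pos_of_mul_eq_two_mul_sq D_pos (Nat.cast_nonneg _) hpN).2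
  have isSymm : (trim (labelMatrix G (observation G x z)) (20 * D ^ 2) -
      meanMatrix p ε x).IsSymm :=
    (trim_isSymm (labelMatrix_observation_isSymm x G z) _).sub (meanMatrix_isSymm p ε x)
  refine (norm_toEuclideanCLM_le isSymm (K := 85000 * D) fun z hz => ?_).trans_eq (by ring)
  exact regular.abs_trim_quadratic_form_le (labelMatrix_observation_eq_upper_add x G _)
    (upper_nonneg (edgeLabel_nonneg x G _)) (upper_mem_Icc (mul_labelRate_mem_Icc p ε x))
    (upper_self _) (fun i j => mul_labelRate_mem_Icc p ε x s(i, j))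
    (fun i j hij => (upper_add_upper_swap (fun e => p * labelRate ε (xorLabel x e)) hij).symm)
    D_pos (p.2.2.trans hD) hpN hz

end MeanApproximation

section Success

lemma one_le_and_lt_and_div_sub_le {K s D δ : ℝ} (hK : 1 ≤ K) (hs : s ≤ 1) (hD : 0 < D)
    (hδ : 0 < δ) (large : K * (1 + 1 / δ) ≤ s * D) :
    1 ≤ D ∧ K * D < s * D ^ 2 ∧ K * D / (s * D ^ 2 - K * D) ≤ δ := by
  have div_le_sub : K * D / δ ≤ s * D ^ 2 - K * D := by
    calc K * D / δ = D * (K * (1 + 1 / δ)) - K * D := by ring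
      _ ≤ D * (s * D) - K * D := by gcongr
      _ = s * D ^ 2 - K * D := by ring
  have gap_pos : 0 < s * D ^ 2 - K * D := (by positivity : 0 < K * D / δ).trans_le div_le_sub
  refine ⟨?_, sub_pos.1 gap_pos, (div_le_comm₀ gap_pos hδ).2 div_le_sub⟩
  calc 1 ≤ K := hK
    _ ≤ K * (1 + 1 / δ) := le_mul_of_one_le_right (by positivity) (by simpa using hδ.le)
    _ ≤ s * D := large
    _ ≤ D := mul_le_of_le_one_left hD.le hs

lemma abs_one_sub_two_mul_le_one (ε : unitInterval) : |1 - 2 * (ε : ℝ)| ≤ 1 :=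
  abs_le.2 ⟨by linarith [ε.2.2], by linarith [ε.2.1]⟩

theorem exists_norm_sub_smul_signVector_le {V : Type*} [Fintype V] [DecidableEq V]
    {p κ l : ℝ} {ε : unitInterval} {x : V → ZMod 2} {A : Matrix V V ℝ}
    {U : Submodule ℝ (EuclideanSpace ℝ V)} {v : EuclideanSpace ℝ V}
    (hx : (block x 0).card = (block x 1).card)
    (hl : l = |1 - 2 * (ε : ℝ)| * (p / 2 * Fintype.card V)) (hκ : 0 ≤ κ) (hκl : κ < l)
    (hA : ‖Matrix.toEuclideanCLM (𝕜 := ℝ) (A - meanMatrix p ε x)‖ ≤ κ)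
    (hU : IsTopEigenspace A U) (hv : v ∈ U) (hv₁ : inner ℝ (onesVector V) v = 0) :
    ∃ c : ℝ, ‖v - c • signVector x‖ ≤ κ / (l - κ) * ‖v‖ := by
  obtain ⟨b, μ, S, hb, hS, hdom, rfl⟩ := hU
  have card_ne_zero : (Fintype.card V : ℝ) ≠ 0 := by
    intro card_eq_zero
    rw [card_eq_zero, mul_zero, mul_zero] at hl
    linarith
  have ne_zero {u : EuclideanSpace ℝ V} (hu : ‖u‖ ^ 2 = Fintype.card V) : u ≠ 0 := by
    rintro rfl
    exact card_ne_zero (by rw [← hu, norm_zero, sq, zero_mul])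
  have mean_mem_span (u : EuclideanSpace ℝ V) : Matrix.toEuclideanLin (meanMatrix p ε x) u ∈
      Submodule.span ℝ {onesVector V, signVector x} :=
    Submodule.mem_span_pair.2 ⟨_, _, (toEuclideanLin_meanMatrix_apply p ε x u).symm⟩
  have near_mean (u : EuclideanSpace ℝ V) :
      ‖Matrix.toEuclideanLin A u - Matrix.toEuclideanLin (meanMatrix p ε x) u‖ ≤ κ * ‖u‖ := by
    rw [← LinearMap.sub_apply, ← map_sub]
    exact (Matrix.toEuclideanCLM (𝕜 := ℝ) (A - meanMatrix p ε x)).le_of_opNorm_le hA u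
  have le_abs_sign : l ≤ |-((1 - 2 * (ε : ℝ)) * (p / 2 * Fintype.card V))| := by
    rw [hl, abs_neg, abs_mul]
    gcongr
    exact le_abs_self _
  have le_abs_ones : l ≤ |p / 2 * Fintype.card V| := by
    rw [abs_neg, abs_mul] at le_abs_sign
    exact le_abs_sign.trans (mul_le_of_le_one_left (abs_nonneg _) (abs_one_sub_two_mul_le_one ε))
  exact exists_norm_sub_smul_le b (fun i => by convert hb i) near_mean hκ hκl
    (ne_zero norm_onesVector_sq) (ne_zero (norm_signVector_sq x)) (inner_onesVector_signVector hx)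
    mean_mem_span (toEuclideanLin_meanMatrix_onesVector p ε hx)
    (toEuclideanLin_meanMatrix_signVector p ε hx) le_abs_ones le_abs_sign hS hdom hv hv₁

variable {n : ℕ} {p ε : unitInterval} {γ δ D : ℝ} {x : Fin (2 * n) → ZMod 2}

theorem mem_successEvent_of_isRegular (hx : (block x 1).card = n) (hδ₀ : 0 < δ) (hδ : δ ≤ 1 / 2)
    (hδγ : 4 * δ ≤ γ) (hD : 0 < D) (hnp : n * (p : ℝ) = D ^ 2)
    (large : 10625 * (1 + 1 / δ) ≤ |1 - 2 * (ε : ℝ)| * D)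
    {ω : SimpleGraph (Fin (2 * n)) × (Sym2 (Fin (2 * n)) → ZMod 2)}
    (regular : IsRegular (upper (edgeLabel x ω.1 ω.2))
      (upper fun e => p * labelRate ε (xorLabel x e)) p D) :
    ω ∈ successEvent n p γ x := by
  have card_eq : (Fintype.card (Fin (2 * n)) : ℝ) = 2 * n := by simp
  have n_pos : 0 < n := by
    have np_pos : 0 < n * (p : ℝ) := hnp ▸ by positivity
    exact_mod_cast pos_of_mul_pos_left np_pos p.2.1
  have threshold_eq : 20 * (p : ℝ) * n = 20 * D ^ 2 := by rw [← hnp]; ring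
  obtain ⟨one_le_D, gap, ratio_le⟩ := one_le_and_lt_and_div_sub_le (by norm_num)
    (abs_one_sub_two_mul_le_one ε) hD hδ₀ large
  refine ⟨exists_isSpectralOutput n_pos p
    (trim_isSymm (labelMatrix_observation_isSymm x ω.1 ω.2) _), ?_⟩
  rintro V₁' _ ⟨U, _, v₂, hU, rfl, hv₂, norm_eq, orthogonal, hV₁', top, rfl⟩
  rw [Submodule.inner_starProjection_left_eq_right,
    Submodule.starProjection_eq_self_iff.2 hv₂] at orthogonal
  obtain ⟨c, near⟩ := exists_norm_sub_smul_signVector_le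
    ((card_block_zero (Fintype.card_fin _) hx).trans hx.symm)
    (by rw [card_eq, ← hnp]; ring) (by positivity) gap
    (threshold_eq ▸ norm_toEuclideanCLM_trim_sub_meanMatrix_le one_le_D
      (by rw [card_eq, ← hnp]; ring) regular) hU hv₂ orthogonal
  rw [norm_eq, mul_one] at near
  exact gammaCorrectPartition_of_norm_sub_smul_le (Fintype.card_fin _) hx norm_eq
    (near.trans ratio_le) hδ hδγ hV₁' top

theorem one_sub_le_law_real_successEvent (hx : (block x 1).card = n) (hδ₀ : 0 < δ)
    (hδ : δ ≤ 1 / 2) (hδγ : 4 * δ ≤ γ) (hD : 0 < D) (hnp : n * (p : ℝ) = D ^ 2)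
    (large : 10625 * (1 + 1 / δ) ≤ |1 - 2 * (ε : ℝ)| * D) :
    1 - 9 / n ≤ (law n p ε).real (successEvent n p γ x) := by
  have card_eq : (Fintype.card (Fin (2 * n)) : ℝ) = 2 * n := by simp
  have irregular_le : (markedGraphLaw (Fin (2 * n)) p ε).real
      {ω | ¬ IsRegular (upper (edgeLabel x ω.1 ω.2))
        (upper fun e => p * labelRate ε (xorLabel x e)) p D} ≤ 9 / n := by
    refine ((expMomentBound_edgeLabel p ε x).measure_not_isRegular_le
      (upper_mem_Icc (mul_labelRate_mem_Icc p ε x)) hD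
      (by rw [card_eq, ← hnp]; ring)).trans_eq ?_
    rw [card_eq, ← div_div]
    norm_num
  have failure_subset : (successEvent n p γ x)ᶜ ⊆
      {ω | ¬ IsRegular (upper (edgeLabel x ω.1 ω.2))
        (upper fun e => p * labelRate ε (xorLabel x e)) p D} :=
    fun ω failure regular =>
      failure (mem_successEvent_of_isRegular hx hδ₀ hδ hδγ hD hnp large regular)
  calc 1 - 9 / (n : ℝ) ≤ 1 - (markedGraphLaw (Fin (2 * n)) p ε).real (successEvent n p γ x)ᶜ := by
        gcongr
        exact (measureReal_mono failure_subset).trans irregular_le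
    _ = (law n p ε).real (successEvent n p γ x) := by
        rw [probReal_compl_eq_one_sub (.of_discrete), sub_sub_cancel]
        rfl

end Success

end

end CensorBlock

theorem theorem1p5_general (γ : ℝ) (hγ : 0 < γ) :
    ∃ C : ℝ, 0 < C ∧ ∀ (ε : unitInterval), (ε : ℝ) ≠ 1 / 2 →
      ∀ (n : ℕ) (p : unitInterval) (x : Fin (2 * n) → ZMod 2),
        (CensorBlock.block x 1).card = n → C / (1 - 2 * (ε : ℝ)) ^ 2 ≤ n * (p : ℝ) →
        1 - 9 / n ≤ (CensorBlock.law n p ε).real (CensorBlock.successEvent n p γ x) := by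
  set δ : ℝ := min (1 / 2) (γ / 4)
  have δ_pos : 0 < δ := lt_min (by norm_num) (by positivity)
  refine ⟨(10625 * (1 + 1 / δ)) ^ 2, by positivity, fun ε hε n p x hx hnp => ?_⟩
  have sq_pos : 0 < (1 - 2 * (ε : ℝ)) ^ 2 := by
    have : 1 - 2 * (ε : ℝ) ≠ 0 := fun h => hε (by linarith)
    positivity
  have np_pos : 0 < n * (p : ℝ) := lt_of_lt_of_le (by positivity) hnp
  set D := √(n * (p : ℝ))
  have D_sq : n * (p : ℝ) = D ^ 2 := (Real.sq_sqrt np_pos.le).symm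
  have large : 10625 * (1 + 1 / δ) ≤ |1 - 2 * (ε : ℝ)| * D := by
    refine le_of_sq_le_sq ?_ (by positivity)
    rwa [mul_pow |1 - 2 * (ε : ℝ)|, sq_abs, ← D_sq, ← div_le_iff₀' sq_pos]
  exact CensorBlock.one_sub_le_law_real_successEvent hx δ_pos (min_le_left _ _)
    (by linarith [min_le_right (1 / 2) (γ / 4)]) (Real.sqrt_pos.2 np_pos) D_sq large

theorem theorem1p5 (γ ε₀ : ℝ) (hγ : 0 < γ) (hε₀ : 0 < ε₀) (hε₀' : ε₀ < 1 / 2) :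
    ∃ C₁ C₂ : ℝ, 0 < C₁ ∧ 0 < C₂ ∧
      ∀ ε : unitInterval, ε₀ ≤ (ε : ℝ) → (ε : ℝ) < 1 / 2 →
        ∃ η : ℕ → ℝ, Tendsto η atTop (𝓝 0) ∧
          ∀ (n : ℕ) (p : unitInterval) (x : Fin (2 * n) → ZMod 2),
            (CensorBlock.block x 1).card = n →
            C₁ / (1 - 2 * (ε : ℝ)) ^ 2 ≤ n * (p : ℝ) →
            C₂ / n ≤ (p : ℝ) →
            1 - η n ≤ (CensorBlock.law n p ε).real (CensorBlock.successEvent n p γ x) := by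
  obtain ⟨C, C_pos, success⟩ := theorem1p5_general γ hγ
  exact ⟨C, 1, C_pos, one_pos, fun ε _ hε =>
    ⟨fun n => 9 / n, tendsto_const_div_atTop_nhds_zero_nat 9,
      fun n p x hx hnp _ => success ε hε.ne n p x hx hnp⟩⟩
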